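/- A class $\mathcal{C}$ of (not necessarily unital) C*-algebras is called upwards directed if every C*-algebra $A$ that contains a C*-subalgebra isomorphic to an algebra in $\mathcal{C}$ is itself in $\mathcal{C}$. A C*-algebra $A$ is hereditarily in $\mathcal{C}$ if every nonzero hereditary C*-subalgebra of $A$ is in $\mathcal{C}$, and residually hereditarily in $\mathcal{C}$ if $A/I$ is hereditarily in $\mathcal{C}$ for every closed two-sided ideal $I \subseteq A$ with $I \neq A$. Let $\mathcal{C}$ be an upwards directed class of C*-algebras, and let $\alpha \colon \mathbb{Z}/2 \to \operatorname{Aut}(A)$ be an arbitrary action of $\mathbb{Z}/2$ on a C*-algebra $A$, with fixed point algebra $A^{\alpha}$ and crossed product $C^*(\mathbb{Z}/2, A, \alpha)$. Then: 1. If $A^{\alpha}$ is hereditarily in $\mathcal{C}$, then $A$ is hereditarily in $\mathcal{C}$. 2. If $A^{\alpha}$ is residually hereditarily in $\mathcal{C}$, then $A$ is residually hereditarily in $\mathcal{C}$. 3. If $A$ is hereditarily in $\mathcal{C}$, then $C^*(\mathbb{Z}/2, A, \alpha)$ is hereditarily in $\mathcal{C}$. 4. If $A$ is residually hereditarily in $\mathcal{C}$,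 then $C^*(\mathbb{Z}/2, A, \alpha)$ is residually hereditarily in $\mathcal{C}$. -/

import Mathlib

universe u v

noncomputable section

/-! ### Closed two-sided ideals and quotient C⋆-algebras -/

/-- An ideal of a C⋆-algebra: a norm closed two-sided ideal (a complex linear subspace). -/
structure CStarIdeal (A : Type u) [NonUnitalCStarAlgebra A] extends Submodule ℂ A where
  mul_mem_left' : ∀ (a : A) {x : A}, x ∈ carrier → a * x ∈ carrier
  mul_mem_right' : ∀ (a : A) {x : A}, x ∈ carrier → x * a ∈ carrier
  isClosed' : IsClosed carrier

namespace CStarIdeal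

variable {A : Type u} [NonUnitalCStarAlgebra A] (I : CStarIdeal A)

/-- The closed star subalgebra of all `x` such that `x` and `star x` lie in `I`. -/
def selfAdjointPart : NonUnitalStarSubalgebra ℂ A where
  carrier := {x | x ∈ I.toSubmodule ∧ star x ∈ I.toSubmodule}
  add_mem' {x y} hx hy := ⟨add_mem hx.1 hy.1, by rw [star_add]; exact add_mem hx.2 hy.2⟩
  zero_mem' := ⟨zero_mem _, by rw [star_zero]; exact zero_mem _⟩
  mul_mem' {x y} hx hy :=
    ⟨I.mul_mem_left' x hy.1, by rw [star_mul]; exact I.mul_mem_left' (star y) hx.2⟩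
  smul_mem' c x hx :=
    ⟨I.toSubmodule.smul_mem c hx.1, by rw [star_smul]; exact I.toSubmodule.smul_mem _ hx.2⟩
  star_mem' {x} hx := ⟨hx.2, by rw [star_star]; exact hx.1⟩

instance : IsClosed (I.selfAdjointPart : Set A) :=
  I.isClosed'.inter (I.isClosed'.preimage continuous_star)

instance : IsClosed (I.toSubmodule : Set A) := I.isClosed'

/-- One-sided approximate units for a closed ideal. -/
lemma exists_approx {x : A} (hx : x ∈ I.toSubmodule) {ε : ℝ} (hε : 0 < ε) :
    ∃ e ∈ I.toSubmodule, star e = e ∧ (∀ z : A, ‖z - z * e‖ ≤ ‖z‖) ∧ ‖x - x * e‖ < ε := by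
  let _ : PartialOrder A := CStarAlgebra.spectralOrder A
  have _ : StarOrderedRing A := CStarAlgebra.spectralOrderedRing A
  let _ : PartialOrder I.selfAdjointPart := CStarAlgebra.spectralOrder _
  have _ : StarOrderedRing I.selfAdjointPart := CStarAlgebra.spectralOrderedRing _
  have hh : star x * x ∈ I.selfAdjointPart := by
    refine ⟨I.mul_mem_left' _ hx, ?_⟩
    rw [star_mul, star_star]
    exact I.mul_mem_left' _ hx
  let h : I.selfAdjointPart := ⟨star x * x, hh⟩
  have hU := CStarAlgebra.increasingApproximateUnit I.selfAdjointPart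
  have h1 : ∀ᶠ e in CStarAlgebra.approximateUnit I.selfAdjointPart,
      ‖h * e - h‖ < ε ^ 2 / 2 := by
    have := (tendsto_iff_norm_sub_tendsto_zero.1 (hU.tendsto_mul_left h))
    exact this.eventually_lt_const (by positivity)
  obtain ⟨e, he1, he2, he3⟩ := (h1.and (hU.eventually_nonneg.and hU.eventually_norm)).exists
  have hstar : star (e : A) = e := by
    have := (IsSelfAdjoint.of_nonneg he2).star_eq
    exact congrArg Subtype.val this
  have he0 : (0 : A) ≤ e := by
    obtain ⟨c, hc⟩ := CStarAlgebra.nonneg_iff_eq_star_mul_self.1 he2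
    rw [hc]
    exact star_mul_self_nonneg (c : A)
  have he1' : ‖(e : A)‖ ≤ 1 := he3
  have hleft : ∀ z : A, ‖z - e * z‖ ≤ ‖z‖ := fun z ↦
    CStarAlgebra.norm_sub_mul_self_le_of_inr z le_rfl he0 he1' (norm_nonneg z) (by
      rw [Unitization.inr_zero, sub_zero, mul_one, CStarRing.norm_star_mul_self,
        Unitization.norm_inr, sq])
  have hright : ∀ z : A, ‖z - z * e‖ ≤ ‖z‖ := fun z ↦ by
    have := hleft (star z)
    rw [norm_star, ← norm_star (_ - _), star_sub, star_mul, star_star, hstar] at this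
    exact this
  refine ⟨e, e.2.1, hstar, hright, ?_⟩
  have h2 : ‖star x * x * e - star x * x‖ < ε ^ 2 / 2 := he1
  have h3 : ‖x - x * e‖ * ‖x - x * e‖ ≤ ‖star x * x * e - star x * x‖ := by
    rw [← CStarRing.norm_star_mul_self]
    have : star (x - x * e) * (x - x * e) =
        -((star x * x * e - star x * x) - e * (star x * x * e - star x * x)) := by
      rw [star_sub, star_mul, hstar]
      noncomm_ring
    rw [this, norm_neg]
    exact hleft _
  nlinarith [norm_nonneg (x - x * (e : A)), sq_nonneg ε]

lemma star_mem {x : A} (hx : x ∈ I.toSubmodule) : star x ∈ I.toSubmodule := by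
  have : star x ∈ closure (I.toSubmodule : Set A) := by
    rw [Metric.mem_closure_iff]
    intro ε hε
    obtain ⟨e, he, hs, -, hlt⟩ := I.exists_approx hx hε
    refine ⟨e * star x, I.mul_mem_right' _ he, ?_⟩
    rw [dist_eq_norm, ← norm_star, star_sub, star_mul, star_star, hs]
    exact hlt
  have hcl : IsClosed (I.toSubmodule : Set A) := I.isClosed'
  rwa [hcl.closure_eq] at this

/-- The quotient `A / I`, with the quotient norm. -/
def Quotient : Type u := A ⧸ I.toSubmodule

namespace Quotient

instance : NormedAddCommGroup I.Quotient :=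
  inferInstanceAs (NormedAddCommGroup (A ⧸ I.toSubmodule))

instance : NormedSpace ℂ I.Quotient :=
  inferInstanceAs (NormedSpace ℂ (A ⧸ I.toSubmodule))

instance : CompleteSpace I.Quotient :=
  inferInstanceAs (CompleteSpace (A ⧸ I.toSubmodule))

/-- The quotient map `A → A / I`. -/
def mk (a : A) : I.Quotient := Submodule.Quotient.mk (p := I.toSubmodule) a

lemma mk_eq_mk {a b : A} : mk I a = mk I b ↔ a - b ∈ I.toSubmodule :=
  Submodule.Quotient.eq _

lemma mk_surjective : Function.Surjective (mk I) := Submodule.Quotient.mk_surjective _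

instance : Mul I.Quotient where
  mul := Quotient.map₂ (· * ·) (by
    intro a b hab c d hcd
    have h1 : a - b ∈ I.toSubmodule := (Submodule.quotientRel_def _).1 hab
    have h2 : c - d ∈ I.toSubmodule := (Submodule.quotientRel_def _).1 hcd
    refine (Submodule.quotientRel_def _).2 ?_
    have : a * c - b * d = (a - b) * c + b * (c - d) := by noncomm_ring
    change a * c - b * d ∈ I.toSubmodule
    rw [this]
    exact add_mem (I.mul_mem_right' c h1) (I.mul_mem_left' b h2))

instance : Star I.Quotient where
  star := Quotient.map star (by
    intro a b hab
    have h1 : a - b ∈ I.toSubmodule := (Submodule.quotientRel_def _).1 hab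
    refine (Submodule.quotientRel_def _).2 ?_
    rw [← star_sub]
    exact I.star_mem h1)

lemma mk_mul (a b : A) : mk I (a * b) = mk I a * mk I b := rfl
lemma mk_star (a : A) : mk I (star a) = star (mk I a) := rfl
lemma mk_add (a b : A) : mk I (a + b) = mk I a + mk I b := rfl
lemma mk_zero : mk I 0 = 0 := rfl
lemma mk_smul (c : ℂ) (a : A) : mk I (c • a) = c • mk I a := rfl

lemma norm_mk_le (a : A) : ‖mk I a‖ ≤ ‖a‖ := Submodule.Quotient.norm_mk_le _ a

lemma norm_mk_lt (x : I.Quotient) {ε : ℝ} (hε : 0 < ε) : ∃ a : A, mk I a = x ∧ ‖a‖ < ‖x‖ + ε :=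
  Submodule.Quotient.norm_mk_lt (S := I.toSubmodule) x hε

instance : NonUnitalNormedRing I.Quotient where
  left_distrib x y z := by
    obtain ⟨a, rfl⟩ := mk_surjective I x
    obtain ⟨b, rfl⟩ := mk_surjective I y
    obtain ⟨c, rfl⟩ := mk_surjective I z
    rw [← mk_add, ← mk_mul, mul_add, mk_add, mk_mul, mk_mul]
  right_distrib x y z := by
    obtain ⟨a, rfl⟩ := mk_surjective I x
    obtain ⟨b, rfl⟩ := mk_surjective I y
    obtain ⟨c, rfl⟩ := mk_surjective I z
    rw [← mk_add, ← mk_mul, add_mul, mk_add, mk_mul, mk_mul]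
  zero_mul x := by
    obtain ⟨a, rfl⟩ := mk_surjective I x
    rw [← mk_zero, ← mk_mul, zero_mul]
  mul_zero x := by
    obtain ⟨a, rfl⟩ := mk_surjective I x
    rw [← mk_zero, ← mk_mul, mul_zero]
  mul_assoc x y z := by
    obtain ⟨a, rfl⟩ := mk_surjective I x
    obtain ⟨b, rfl⟩ := mk_surjective I y
    obtain ⟨c, rfl⟩ := mk_surjective I z
    rw [← mk_mul, ← mk_mul, ← mk_mul, ← mk_mul, mul_assoc]
  dist_eq := dist_eq_norm_neg_add
  norm_mul_le x y := by
    refine le_of_forall_pos_le_add fun ε hε ↦ ?_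
    have hlim : Filter.Tendsto (fun δ : ℝ ↦ (‖x‖ + δ) * (‖y‖ + δ)) (nhdsWithin 0 (Set.Ioi 0))
        (nhds ((‖x‖ + 0) * (‖y‖ + 0))) :=
      (Continuous.tendsto (by fun_prop) (0 : ℝ)).mono_left nhdsWithin_le_nhds
    have hev := hlim.eventually_lt_const (u := ‖x‖ * ‖y‖ + ε) (by simpa using hε)
    obtain ⟨δ, hδ1, hδ⟩ := (hev.and self_mem_nhdsWithin).exists
    obtain ⟨a, rfl, ha⟩ := norm_mk_lt I x hδ
    obtain ⟨b, rfl, hb⟩ := norm_mk_lt I y hδ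
    rw [← mk_mul]
    refine (norm_mk_le I _).trans ((norm_mul_le a b).trans (le_trans ?_ hδ1.le))
    gcongr

instance : StarRing I.Quotient where
  star_involutive x := by
    obtain ⟨a, rfl⟩ := mk_surjective I x
    rw [← mk_star, ← mk_star, star_star]
  star_mul x y := by
    obtain ⟨a, rfl⟩ := mk_surjective I x
    obtain ⟨b, rfl⟩ := mk_surjective I y
    rw [← mk_mul, ← mk_star, star_mul, mk_mul, mk_star, mk_star]
  star_add x y := by
    obtain ⟨a, rfl⟩ := mk_surjective I x
    obtain ⟨b, rfl⟩ := mk_surjective I y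
    rw [← mk_add, ← mk_star, star_add, mk_add, mk_star, mk_star]

/-- The C⋆-algebra structure of the quotient of a C⋆-algebra by a closed two-sided ideal. -/
instance : NonUnitalCStarAlgebra I.Quotient where
  norm_mul_self_le x := by
    obtain ⟨a, rfl⟩ := mk_surjective I x
    rw [← mk_star, ← mk_mul]
    refine le_of_forall_pos_le_add fun ε hε ↦ ?_
    obtain ⟨m, hm, hlt⟩ := norm_mk_lt I (mk I (star a * a)) (half_pos hε)
    have hy : m - star a * a ∈ I.toSubmodule := (mk_eq_mk I).1 hm
    obtain ⟨e, heI, hs, he, hye⟩ := I.exists_approx hy (half_pos hε)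
    have hleft : ∀ z : A, ‖z - e * z‖ ≤ ‖z‖ := fun z ↦ by
      have := he (star z)
      rw [norm_star, ← norm_star (_ - _), star_sub, star_mul, star_star, hs] at this
      exact this
    have hmk : mk I a = mk I (a - a * e) := by
      rw [mk_eq_mk, sub_sub_cancel]
      exact I.mul_mem_left' a heI
    have hle : ‖mk I a‖ ≤ ‖a - a * e‖ := hmk ▸ norm_mk_le I (a - a * e)
    have key : star (a - a * e) * (a - a * e) = ((m - m * e) - e * (m - m * e)) -
        (((m - star a * a) - (m - star a * a) * e) -
          e * ((m - star a * a) - (m - star a * a) * e)) := by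
      rw [star_sub, star_mul, hs]
      noncomm_ring
    calc ‖mk I a‖ * ‖mk I a‖ ≤ ‖a - a * e‖ * ‖a - a * e‖ := by gcongr
      _ = ‖star (a - a * e) * (a - a * e)‖ := CStarRing.norm_star_mul_self.symm
      _ ≤ ‖m‖ + ε / 2 := by
        rw [key]
        refine (norm_sub_le _ _).trans (add_le_add ?_ ?_)
        · exact (hleft _).trans (he m)
        · exact (hleft _).trans hye.le
      _ ≤ ‖mk I (star a * a)‖ + ε := by linarith
  smul_assoc c x y := by
    obtain ⟨a, rfl⟩ := mk_surjective I x
    obtain ⟨b, rfl⟩ := mk_surjective I y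
    change mk I ((c • a) * b) = mk I (c • (a * b))
    rw [smul_mul_assoc]
  smul_comm c x y := by
    obtain ⟨a, rfl⟩ := mk_surjective I x
    obtain ⟨b, rfl⟩ := mk_surjective I y
    change mk I (c • (a * b)) = mk I (a * (c • b))
    rw [mul_smul_comm]
  star_smul c x := by
    obtain ⟨a, rfl⟩ := mk_surjective I x
    change mk I (star (c • a)) = mk I (star c • star a)
    rw [star_smul]

end Quotient

end CStarIdeal

/-! ### Classes of C⋆-algebras and (residual) hereditary membership -/

/-- A class of (not necessarily unital) C⋆-algebras. -/
abbrev CStarClass := ∀ (A : Type u) [NonUnitalCStarAlgebra A], Prop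

/-- A class `𝒞` is upwards directed if every C⋆-algebra `A` which contains a C⋆-subalgebra `S`
isomorphic to an algebra `B` in `𝒞` is itself in `𝒞`. -/
def CStarClass.UpwardsDirected (𝒞 : CStarClass.{u}) : Prop :=
  ∀ (A : Type u) [NonUnitalCStarAlgebra A] (B : Type u) [NonUnitalCStarAlgebra B]
    (S : NonUnitalStarSubalgebra ℂ A), IsClosed (S : Set A) → Nonempty (B ≃⋆ₐ[ℂ] S) → 𝒞 B → 𝒞 A

/-- A C⋆-subalgebra `B` of `A` is hereditary if `0 ≤ a ≤ b` and `b ∈ B` imply `a ∈ B`, for the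
usual order of the C⋆-algebra `A`. -/
structure IsHereditarySubalgebra {A : Type u} [NonUnitalCStarAlgebra A]
    (B : NonUnitalStarSubalgebra ℂ A) : Prop where
  isClosed : IsClosed (B : Set A)
  mem_of_le : letI : PartialOrder A := CStarAlgebra.spectralOrder A
    ∀ a b : A, 0 ≤ a → a ≤ b → b ∈ B → a ∈ B

/-- `A` is hereditarily in `𝒞` if every nonzero hereditary subalgebra of `A` is in `𝒞`. -/
def HereditarilyIn (𝒞 : CStarClass.{u}) (A : Type u) [NonUnitalCStarAlgebra A] : Prop :=
  ∀ (B : NonUnitalStarSubalgebra ℂ A) (hB : IsHereditarySubalgebra B), B ≠ ⊥ →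
    haveI : IsClosed (B : Set A) := hB.isClosed
    𝒞 B

/-- `A` is residually hereditarily in `𝒞` if `A / I` is hereditarily in `𝒞` for every ideal
`I ≠ A`. -/
def ResiduallyHereditarilyIn (𝒞 : CStarClass.{u}) (A : Type u) [NonUnitalCStarAlgebra A] : Prop :=
  ∀ I : CStarIdeal A, I.toSubmodule ≠ ⊤ → HereditarilyIn 𝒞 I.Quotient

/-! ### Actions, fixed point algebras and crossed products -/

section Actions

variable {G : Type v} [Group G] {A : Type u} [NonUnitalCStarAlgebra A]

/-- The fixed point algebra of an action `α` of a group on a C⋆-algebra. -/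
def fixedPointAlgebra (α : G →* (A ≃⋆ₐ[ℂ] A)) : NonUnitalStarSubalgebra ℂ A where
  carrier := {a | ∀ g, α g a = a}
  add_mem' {a b} ha hb g := by rw [map_add, ha g, hb g]
  zero_mem' g := map_zero _
  mul_mem' {a b} ha hb g := by rw [map_mul, ha g, hb g]
  smul_mem' c a ha g := by rw [map_smul, ha g]
  star_mem' {a} ha g := by rw [map_star, ha g]

instance (α : G →* (A ≃⋆ₐ[ℂ] A)) : IsClosed (fixedPointAlgebra α : Set A) := by
  have : (fixedPointAlgebra α : Set A) = ⋂ g, {a | α g a = a} := by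
    ext a
    simp only [Set.mem_iInter]
    rfl
  rw [this]
  exact isClosed_iInter fun g ↦ isClosed_eq
    (StarAlgEquiv.isometry (α g)).continuous continuous_id

/-- The underlying space of the crossed product of `A` by an action `α` of a finite group `G`:
functions `G → A`, the function `f` standing for the sum `∑ g, f g • u_g`. As `G` is finite, all
functions are integrable, and no completion is needed: the space is complete in the norm below. -/
def CrossedProduct (_α : G →* (A ≃⋆ₐ[ℂ] A)) : Type (max u v) := G → A

namespace CrossedProduct

variable (α : G →* (A ≃⋆ₐ[ℂ] A))

instance : AddCommGroup (CrossedProduct α) := inferInstanceAs (AddCommGroup (G → A))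
instance : Module ℂ (CrossedProduct α) := inferInstanceAs (Module ℂ (G → A))

/-- The involution `f⋆ g = α_g (f (g⁻¹)⋆)`. -/
instance : Star (CrossedProduct α) := ⟨fun f g ↦ α g (star (f g⁻¹))⟩

variable {α} in
@[ext] lemma ext {f f' : CrossedProduct α} (h : ∀ g, f g = f' g) : f = f' := funext h

lemma add_apply (f f' : CrossedProduct α) (g : G) : (f + f') g = f g + f' g := rfl
lemma smul_apply (c : ℂ) (f : CrossedProduct α) (g : G) : (c • f) g = c • f g := rfl
lemma star_apply (f : CrossedProduct α) (g : G) : (star f) g = α g (star (f g⁻¹)) := rfl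

/-- The regular representation, by matrices over `A` indexed by `G`. -/
def regular (f : CrossedProduct α) : CStarMatrix G G A :=
  CStarMatrix.ofMatrix fun g h ↦ α g⁻¹ (f (g * h⁻¹))

lemma regular_apply (f : CrossedProduct α) (g h : G) :
    regular α f g h = α g⁻¹ (f (g * h⁻¹)) := rfl

/-- The function with value `a` at `g` and zero elsewhere. -/
def single [DecidableEq G] (g : G) (a : A) : CrossedProduct α := (Pi.single g a : G → A)

lemma single_apply [DecidableEq G] (g h : G) (a : A) : single α g a h = if h = g then a else 0 :=
  Pi.single_apply g a h

variable [Fintype G]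

/-- Twisted convolution `(f * f') g = ∑ h, f h * α_h (f' (h⁻¹ * g))`. -/
instance : Mul (CrossedProduct α) := ⟨fun f f' g ↦ ∑ h, f h * α h (f' (h⁻¹ * g))⟩

lemma mul_apply (f f' : CrossedProduct α) (g : G) :
    (f * f') g = ∑ h, f h * α h (f' (h⁻¹ * g)) := rfl

lemma regular_injective : Function.Injective (regular α) := by
  intro f f' h
  ext g
  have := congrFun (congrFun h g) 1
  rw [regular_apply, regular_apply, inv_one, mul_one] at this
  exact (α g⁻¹).injective this

lemma regular_mul (f f' : CrossedProduct α) :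
    regular α (f * f') = regular α f * regular α f' := by
  ext g k
  rw [CStarMatrix.mul_apply, regular_apply, mul_apply, map_sum]
  refine Fintype.sum_equiv ((Equiv.inv G).trans (Equiv.mulRight g)) _ _ fun t ↦ ?_
  have h1 : (((Equiv.inv G).trans (Equiv.mulRight g)) t : G) = t⁻¹ * g := rfl
  rw [h1, regular_apply, regular_apply, map_mul, ← StarAlgEquiv.mul_apply, ← map_mul]
  congr 3 <;> group

lemma regular_star (f : CrossedProduct α) : regular α (star f) = star (regular α f) := by
  ext g k
  rw [CStarMatrix.star_apply, regular_apply, regular_apply, star_apply,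
    ← StarAlgEquiv.mul_apply, ← map_mul, ← map_star]
  congr 3 <;> group

instance : NonUnitalRing (CrossedProduct α) where
  left_distrib f f₁ f₂ := by
    ext g
    simp only [mul_apply, add_apply, map_add, mul_add, Finset.sum_add_distrib]
  right_distrib f f₁ f₂ := by
    ext g
    simp only [mul_apply, add_apply, add_mul, Finset.sum_add_distrib]
  zero_mul f := by
    ext g
    exact Finset.sum_eq_zero fun h _ ↦ zero_mul _
  mul_zero f := by
    ext g
    refine Finset.sum_eq_zero fun h _ ↦ ?_
    change f h * α h 0 = 0
    rw [map_zero, mul_zero]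
  mul_assoc f f₁ f₂ := regular_injective α (by simp only [regular_mul, mul_assoc])

instance : StarRing (CrossedProduct α) where
  star_involutive f := regular_injective α (by simp only [regular_star, star_star])
  star_mul f f' := regular_injective α (by simp only [regular_star, regular_mul, star_mul])
  star_add f f' := by
    ext g
    simp only [star_apply, add_apply, star_add, map_add]

instance : IsScalarTower ℂ (CrossedProduct α) (CrossedProduct α) where
  smul_assoc c f f' := by
    ext g
    simp only [smul_eq_mul, smul_apply, mul_apply, smul_mul_assoc, Finset.smul_sum]

instance : SMulCommClass ℂ (CrossedProduct α) (CrossedProduct α) where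
  smul_comm c f f' := by
    ext g
    simp only [smul_eq_mul, smul_apply, mul_apply, map_smul, mul_smul_comm, Finset.smul_sum]

instance : StarModule ℂ (CrossedProduct α) where
  star_smul c f := by
    ext g
    simp only [smul_apply, star_apply, star_smul, map_smul]

/-- The regular representation as a star homomorphism. -/
def regularHom : CrossedProduct α →⋆ₙₐ[ℂ] CStarMatrix G G A where
  toFun := regular α
  map_smul' c f := by
    ext g h
    exact map_smul (α g⁻¹) c _
  map_zero' := by
    ext g h
    exact map_zero (α g⁻¹)
  map_add' f f' := by
    ext g h
    exact map_add (α g⁻¹) _ _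
  map_mul' := regular_mul α
  map_star' := regular_star α

/-- The numbers `‖π f‖`, for all star homomorphisms `π` of the convolution algebra to
C⋆-algebras. -/
def normSet (f : CrossedProduct α) : Set ℝ :=
  {r | ∃ (B : Type (max u v)) (_ : NonUnitalCStarAlgebra B) (π : CrossedProduct α →⋆ₙₐ[ℂ] B),
    r = ‖π f‖}

/-- The norm of the full crossed product: the largest C⋆-seminorm, which is the supremum of
`‖π f‖` over all star homomorphisms `π` to C⋆-algebras. -/
instance : Norm (CrossedProduct α) := ⟨fun f ↦ sSup (normSet α f)⟩

lemma norm_def (f : CrossedProduct α) : ‖f‖ = sSup (normSet α f) := rfl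

section Single

variable [DecidableEq G]

lemma sum_single (f : CrossedProduct α) : ∑ g, single α g (f g) = f :=
  Finset.univ_sum_single (M := fun _ : G ↦ A) f

lemma single_mul_single (g h : G) (a b : A) :
    single α g a * single α h b = single α (g * h) (a * α g b) := by
  ext k
  rw [mul_apply, Finset.sum_eq_single g]
  · rw [single_apply, single_apply, single_apply, if_pos rfl]
    by_cases hk : k = g * h
    · rw [if_pos hk, if_pos (by rw [hk, inv_mul_cancel_left])]
    · rw [if_neg hk, if_neg (fun h' ↦ hk (by rw [← h', mul_inv_cancel_left])), map_zero, mul_zero]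
  · intro t _ ht
    rw [single_apply, if_neg ht, zero_mul]
  · intro h
    exact absurd (Finset.mem_univ g) h

lemma star_single (g : G) (a : A) : star (single α g a) = single α g⁻¹ (α g⁻¹ (star a)) := by
  ext k
  rw [star_apply, single_apply, single_apply]
  by_cases hk : k = g⁻¹
  · rw [if_pos hk, if_pos (by rw [hk, inv_inv]), hk]
  · rw [if_neg hk, if_neg (fun h ↦ hk (by rw [← h, inv_inv])), star_zero, map_zero]

/-- The embedding of `A` in the crossed product. -/
def incl : A →⋆ₙₐ[ℂ] CrossedProduct α where
  toFun a := single α 1 a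
  map_smul' c a := Pi.single_smul (f := fun _ : G ↦ A) 1 c a
  map_zero' := Pi.single_zero (M := fun _ : G ↦ A) 1
  map_add' a b := Pi.single_add (f := fun _ : G ↦ A) 1 a b
  map_mul' a b := by rw [single_mul_single, mul_one, map_one, StarAlgEquiv.one_apply]
  map_star' a := by rw [star_single, inv_one, map_one, StarAlgEquiv.one_apply]

lemma incl_apply (a : A) : incl α a = single α 1 a := rfl

lemma norm_single_le {B : Type*} [NonUnitalCStarAlgebra B] (π : CrossedProduct α →⋆ₙₐ[ℂ] B)
    (g : G) (a : A) : ‖π (single α g a)‖ ≤ ‖a‖ := by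
  have h1 : ‖π (single α g a)‖ * ‖π (single α g a)‖ = ‖(π.comp (incl α)) (a * star a)‖ := by
    rw [← CStarRing.norm_self_mul_star, ← map_star, ← map_mul, star_single, single_mul_single,
      ← StarAlgEquiv.mul_apply, ← map_mul, mul_inv_cancel, map_one, StarAlgEquiv.one_apply]
    rfl
  have h2 : ‖(π.comp (incl α)) (a * star a)‖ ≤ ‖a‖ * ‖a‖ := by
    rw [← CStarRing.norm_self_mul_star]
    exact NonUnitalStarAlgHom.norm_apply_le _ _
  nlinarith [norm_nonneg a, norm_nonneg (π (single α g a))]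

end Single

lemma norm_map_le_sum {B : Type*} [NonUnitalCStarAlgebra B] (π : CrossedProduct α →⋆ₙₐ[ℂ] B)
    (f : CrossedProduct α) : ‖π f‖ ≤ ∑ g, ‖f g‖ := by
  classical
  rw [← sum_single α f, map_sum]
  refine (norm_sum_le _ _).trans (Finset.sum_le_sum fun g _ ↦ ?_)
  rw [sum_single α f]
  exact norm_single_le α π g (f g)

lemma bddAbove_normSet (f : CrossedProduct α) : BddAbove (normSet α f) := by
  refine ⟨∑ g, ‖f g‖, ?_⟩
  rintro r ⟨B, _, π, rfl⟩
  exact norm_map_le_sum α π f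

lemma norm_map_le {B : Type (max u v)} [NonUnitalCStarAlgebra B]
    (π : CrossedProduct α →⋆ₙₐ[ℂ] B) (f : CrossedProduct α) : ‖π f‖ ≤ ‖f‖ :=
  le_csSup (bddAbove_normSet α f) ⟨B, _, π, rfl⟩

lemma normSet_nonempty (f : CrossedProduct α) : (normSet α f).Nonempty :=
  let _ : PartialOrder A := CStarAlgebra.spectralOrder A
  have _ : StarOrderedRing A := CStarAlgebra.spectralOrderedRing A
  ⟨_, CStarMatrix G G A, inferInstance, regularHom α, rfl⟩

lemma norm_le_of_forall {f : CrossedProduct α} {C : ℝ}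
    (h : ∀ (B : Type (max u v)) [NonUnitalCStarAlgebra B] (π : CrossedProduct α →⋆ₙₐ[ℂ] B),
      ‖π f‖ ≤ C) : ‖f‖ ≤ C := by
  refine csSup_le (normSet_nonempty α f) ?_
  rintro r ⟨B, _, π, rfl⟩
  exact h B π

lemma norm_le_sum (f : CrossedProduct α) : ‖f‖ ≤ ∑ g, ‖f g‖ :=
  norm_le_of_forall α fun _ _ π ↦ norm_map_le_sum α π f

lemma norm_apply_le (f : CrossedProduct α) (g : G) : ‖f g‖ ≤ ‖f‖ := by
  let _ : PartialOrder A := CStarAlgebra.spectralOrder A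
  have _ : StarOrderedRing A := CStarAlgebra.spectralOrderedRing A
  refine le_trans ?_ ((CStarMatrix.norm_entry_le_norm (M := regularHom α f) (i := g)
    (j := 1)).trans (norm_map_le α (regularHom α) f))
  change _ ≤ ‖α g⁻¹ (f (g * 1⁻¹))‖
  rw [StarAlgEquiv.norm_map, inv_one, mul_one]

lemma norm_nonneg' (f : CrossedProduct α) : 0 ≤ ‖f‖ :=
  (norm_nonneg _).trans (norm_apply_le α f 1)

lemma normCore : NormedSpace.Core ℂ (CrossedProduct α) where
  norm_nonneg := norm_nonneg' α
  norm_smul c f := by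
    have hle : ∀ (c : ℂ) (f : CrossedProduct α), ‖c • f‖ ≤ ‖c‖ * ‖f‖ := fun c f ↦ by
      refine norm_le_of_forall α fun B _ π ↦ ?_
      rw [map_smul, norm_smul]
      exact mul_le_mul_of_nonneg_left (norm_map_le α π f) (norm_nonneg c)
    refine le_antisymm (hle c f) ?_
    by_cases hc : c = 0
    · rw [hc, norm_zero, zero_mul]
      exact norm_nonneg' α _
    · have := hle c⁻¹ (c • f)
      rw [inv_smul_smul₀ hc, norm_inv] at this
      have hpos : 0 < ‖c‖ := norm_pos_iff.2 hc
      rwa [inv_mul_eq_div, le_div_iff₀ hpos, mul_comm] at this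
  norm_triangle f f' := by
    refine norm_le_of_forall α fun B _ π ↦ ?_
    rw [map_add]
    exact (norm_add_le _ _).trans (add_le_add (norm_map_le α π f) (norm_map_le α π f'))
  norm_eq_zero_iff f := by
    constructor
    · intro h
      ext g
      exact norm_le_zero_iff.1 (h ▸ norm_apply_le α f g)
    · rintro rfl
      refine le_antisymm (norm_le_of_forall α fun B _ π ↦ ?_) (norm_nonneg' α _)
      rw [map_zero, norm_zero]

instance : NormedAddCommGroup (CrossedProduct α) := .ofCore (normCore α)

instance : NormedSpace ℂ (CrossedProduct α) := .ofCore (normCore α)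

instance : NonUnitalNormedRing (CrossedProduct α) where
  dist_eq := dist_eq_norm_neg_add
  norm_mul_le f f' := by
    refine norm_le_of_forall α fun B _ π ↦ ?_
    rw [map_mul]
    exact (norm_mul_le _ _).trans
      (mul_le_mul (norm_map_le α π f) (norm_map_le α π f') (norm_nonneg _) (norm_nonneg _))

instance : CompleteSpace (CrossedProduct α) := by
  let e : CrossedProduct α ≃ₗ[ℂ] (G → A) := LinearEquiv.refl ℂ (G → A)
  have h1 : ∀ f, ‖e f‖ ≤ 1 * ‖f‖ := fun f ↦ by
    rw [one_mul]
    exact (pi_norm_le_iff_of_nonneg (norm_nonneg f)).2 (norm_apply_le α f)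
  have h2 : ∀ f, ‖e.symm f‖ ≤ (Fintype.card G : ℝ) * ‖f‖ := fun f ↦ by
    refine (norm_le_sum α (e.symm f)).trans ?_
    refine (Finset.sum_le_card_nsmul _ _ ‖f‖ fun g _ ↦ norm_le_pi_norm f g).trans ?_
    rw [nsmul_eq_mul, Finset.card_univ]
  let E := e.toContinuousLinearEquivOfBounds 1 (Fintype.card G) h1 h2
  exact (completeSpace_congr (e := E.toEquiv) E.isUniformEmbedding).2 inferInstance

/-- The full crossed product `C⋆(G, A, α)` of a C⋆-algebra by an action of a finite group. -/
instance : NonUnitalCStarAlgebra (CrossedProduct α) where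
  norm_mul_self_le f := by
    have h : ‖f‖ ≤ Real.sqrt ‖star f * f‖ := by
      refine norm_le_of_forall α fun B _ π ↦ Real.le_sqrt_of_sq_le ?_
      rw [sq, ← CStarRing.norm_star_mul_self, ← map_star, ← map_mul]
      exact norm_map_le α π _
    calc ‖f‖ * ‖f‖ ≤ Real.sqrt ‖star f * f‖ * Real.sqrt ‖star f * f‖ := by gcongr
      _ = ‖star f * f‖ := Real.mul_self_sqrt (norm_nonneg _)

end CrossedProduct

end Actions

end

/-! Statements 3 and 4 are instances of 1 and 2: the dual action on the crossed product is an
involution whose fixed point algebra is the copy of `A`. So let σ be an involutive automorphism of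
`A` with fixed point algebra `F`.

Upwards directedness says that membership in `𝒞` passes up along injective star homomorphisms. For
`F` hereditarily in `𝒞` and a nonzero hereditary `B`, it is thus enough to embed a nonzero
hereditary subalgebra of `F` into `B`. If `B A σ(B) = 0`, then `b ↦ b + σ b` identifies `B` itself
with a hereditary subalgebra of `F` (`of_mul_map_eq_zero`). Otherwise some nonzero `y = b m σ(b⋆)`
satisfies `σ y = y⋆`. With `s = (y y⋆)^(1/2)`, one of `c = s ± y⋆` is nonzero; then `c⋆ A c ⊆ B`,
and `c c⋆` is fixed by σ (`exists_fixed_mul_star`). Cutting `c` down by functional calculus of `c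
c⋆` gives `w` such that `f ↦ w⋆ f w` embeds a hereditary piece of `F` into `B`
(`of_fixed_mul_star`).

For the residual version, σ descends to `A / J` for invariant `J`, and the fixed points there are a
quotient of `F`. A general ideal `I` is squeezed between the invariant ideals `I ∩ σ⁻¹(I)` and the
closure of `I + σ⁻¹(I)`: a hereditary subalgebra of `A / I` either contains a copy of one from the
first quotient or embeds into the second. -/

/-! ### Hereditary subalgebras as closed subalgebras `B` with `B A B ⊆ B` -/

section Hereditary

variable {A : Type u} [NonUnitalCStarAlgebra A] {B : NonUnitalStarSubalgebra ℂ A}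

/-- A hereditary subalgebra `B` of `A` satisfies `B A B ⊆ B`. -/
lemma IsHereditarySubalgebra.mul_mul_mem (hB : IsHereditarySubalgebra B) {b c : A} (hb : b ∈ B)
    (a : A) (hc : c ∈ B) : b * a * c ∈ B := by
  let _ : PartialOrder A := CStarAlgebra.spectralOrder A
  have _ : StarOrderedRing A := CStarAlgebra.spectralOrderedRing A
  -- Positive elements span `A`, so `a ≥ 0` may be assumed. Then `d a d⋆ ≤ ‖a‖ d d⋆` puts `d a d⋆`
  -- in `B` for `d ∈ B`, and polarization over `d = b ± c⋆, b ± i c⋆` recovers `b a c`.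
  have ha : a ∈ Submodule.span ℂ {a : A | 0 ≤ a} := by
    rw [CStarAlgebra.span_nonneg]
    trivial
  induction ha using Submodule.span_induction with
  | zero => simp
  | add x y _ _ hx hy =>
    rw [mul_add, add_mul]
    exact add_mem hx hy
  | smul t x _ hx =>
    rw [mul_smul_comm, smul_mul_assoc]
    exact SMulMemClass.smul_mem t hx
  | mem a ha =>
    have key : ∀ d ∈ B, d * a * star d ∈ B := fun d hd ↦ by
      have h1 : d * a * star d ≤ ‖a‖ • (d * star d) :=
        CStarAlgebra.star_right_conjugate_le_norm_smul (IsSelfAdjoint.of_nonneg ha)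
      refine hB.mem_of_le _ _ (star_right_conjugate_nonneg ha d) h1 ?_
      have := SMulMemClass.smul_mem (‖a‖ : ℂ) (mul_mem hd (star_mem hd))
      rwa [Complex.coe_smul] at this
    have hc' : star c ∈ B := star_mem hc
    have h1 := key _ (add_mem hb hc')
    have h2 := key _ (sub_mem hb hc')
    have h3 := key _ (add_mem hb (SMulMemClass.smul_mem Complex.I hc'))
    have h4 := key _ (sub_mem hb (SMulMemClass.smul_mem Complex.I hc'))
    have h5 := SMulMemClass.smul_mem (4⁻¹ : ℂ)
      (add_mem (sub_mem h1 h2) (SMulMemClass.smul_mem Complex.I (sub_mem h3 h4)))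
    convert h5 using 1
    simp only [star_add, star_sub, star_smul, star_star, add_mul, mul_add, sub_mul, mul_sub,
      smul_mul_assoc, mul_smul_comm, smul_add, smul_sub, smul_smul, Complex.star_def,
      Complex.conj_I]
    match_scalars <;> simp <;> ring_nf

/-- A closed subalgebra `B` of `A` with `B A B ⊆ B` is hereditary. -/
lemma IsHereditarySubalgebra.of_mul_mul_mem (hcl : IsClosed (B : Set A))
    (h : ∀ b ∈ B, ∀ a : A, ∀ c ∈ B, b * a * c ∈ B) : IsHereditarySubalgebra B := by
  refine ⟨hcl, ?_⟩
  let _ : PartialOrder A := CStarAlgebra.spectralOrder A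
  have _ : StarOrderedRing A := CStarAlgebra.spectralOrderedRing A
  intro a b ha hab hb
  let _ : PartialOrder B := CStarAlgebra.spectralOrder _
  have _ : StarOrderedRing B := CStarAlgebra.spectralOrderedRing _
  have hU := CStarAlgebra.increasingApproximateUnit B
  obtain ⟨r, hr, hrr⟩ : ∃ r : A, star r = r ∧ r * r = a :=
    ⟨CFC.sqrt a, (IsSelfAdjoint.of_nonneg (CFC.sqrt_nonneg a)).star_eq, CFC.sqrt_mul_sqrt_self a⟩
  obtain ⟨d, hd⟩ := CStarAlgebra.nonneg_iff_eq_star_mul_self.1 (sub_nonneg.2 hab)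
  -- For `e` from an approximate unit of `B`, `(1 - e) a (1 - e) ≤ (1 - e) b (1 - e)`, and the right
  -- side is small. Hence `r e` is close to `r = a^(1/2)`, and `a` is a limit of elements `e a e ∈
  -- B`.
  have key : ∀ ε : ℝ, 0 < ε → ∃ e ∈ B, star e = e ∧ ‖e‖ ≤ 1 ∧ ‖r - r * e‖ ^ 2 ≤ ε := by
    intro ε hε
    have h1 : ∀ᶠ e in CStarAlgebra.approximateUnit B, ‖(⟨b, hb⟩ : B) * e - ⟨b, hb⟩‖ < ε / 2 := by
      have := tendsto_iff_norm_sub_tendsto_zero.1 (hU.tendsto_mul_left ⟨b, hb⟩)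
      exact this.eventually_lt_const (by positivity)
    obtain ⟨e, he1, he2, he3⟩ := (h1.and (hU.eventually_nonneg.and hU.eventually_norm)).exists
    have hs : star (e : A) = e := congrArg Subtype.val (IsSelfAdjoint.of_nonneg he2).star_eq
    have he1' : ‖b * e - b‖ < ε / 2 := he1
    have he3' : ‖(e : A)‖ ≤ 1 := he3
    refine ⟨e, e.2, hs, he3', ?_⟩
    have h2 : star (r - r * e) * (r - r * e) ≤ e * (b * e - b) - (b * e - b) := by
      rw [← sub_nonneg]
      have : e * (b * e - b) - (b * (e : A) - b) - star (r - r * e) * (r - r * e) =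
          star (d - d * e) * (d - d * e) := by
        have h3 : b = star d * d + r * r := by rw [← hd, hrr, sub_add_cancel]
        rw [h3]
        simp only [star_sub, star_mul, hr, hs]
        noncomm_ring
      rw [this]
      exact star_mul_self_nonneg _
    have h3 := CStarAlgebra.norm_le_norm_of_nonneg_of_le (star_mul_self_nonneg _) h2
    rw [CStarRing.norm_star_mul_self, ← sq] at h3
    refine h3.trans ((norm_sub_le _ _).trans ?_)
    have h4 : ‖(e : A) * (b * e - b)‖ ≤ 1 * (ε / 2) :=
      (norm_mul_le _ _).trans (mul_le_mul he3' he1'.le (norm_nonneg _) zero_le_one)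
    linarith
  have hmem : a ∈ closure (B : Set A) := by
    rw [Metric.mem_closure_iff]
    intro ε hε
    set δ : ℝ := ε / (2 * (‖r‖ + 1)) with hδ
    have hδ0 : 0 < δ := by positivity
    obtain ⟨e, he, hs, h1, h2⟩ := key (δ ^ 2) (by positivity)
    have h3 : ‖r - r * e‖ ≤ δ := by
      exact (sq_le_sq₀ (norm_nonneg _) hδ0.le).1 h2
    have h4 : ‖r - e * r‖ ≤ δ := by
      rw [← norm_star, star_sub, star_mul, hr, hs]
      exact h3
    refine ⟨e * a * e, h e he a e he, ?_⟩
    rw [dist_eq_norm]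
    have : a - e * a * e = (r - e * r) * r + e * r * (r - r * e) := by
      rw [← hrr]
      noncomm_ring
    rw [this]
    calc ‖(r - e * r) * r + e * r * (r - r * e)‖ ≤ δ * ‖r‖ + 1 * ‖r‖ * δ := by
          refine (norm_add_le _ _).trans (add_le_add ?_ ?_)
          · exact (norm_mul_le _ _).trans (by gcongr)
          · refine (norm_mul_le _ _).trans ?_
            have := norm_mul_le e r
            have := mul_le_mul_of_nonneg_right h1 (norm_nonneg r)
            gcongr
            linarith
      _ < 2 * (‖r‖ + 1) * δ := by nlinarith
      _ = ε := by rw [hδ]; field_simp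
  rwa [hcl.closure_eq] at hmem

end Hereditary

/-! ### Factoring star homomorphisms through injective and surjective ones -/

namespace NonUnitalStarAlgHom

variable {A B D : Type*} [NonUnitalCStarAlgebra A] [NonUnitalCStarAlgebra B]

/-- A star homomorphism whose values are values of an injective one factors through it. -/
lemma exists_comp_eq_of_injective [NonUnitalCStarAlgebra D] (φ : B →⋆ₙₐ[ℂ] A) (ψ : D →⋆ₙₐ[ℂ] A)
    (hφ : Function.Injective φ) (h : ∀ d, ∃ b, φ b = ψ d) :
    ∃ χ : D →⋆ₙₐ[ℂ] B, ∀ d, φ (χ d) = ψ d := by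
  choose f hf using h
  exact ⟨{
    toFun := f
    map_smul' := fun c x ↦ hφ (by simp [hf])
    map_zero' := hφ (by simp [hf])
    map_add' := fun x y ↦ hφ (by simp [hf])
    map_mul' := fun x y ↦ hφ (by simp [hf])
    map_star' := fun x ↦ hφ (by simp [hf, map_star]) }, hf⟩

/-- A star homomorphism which vanishes on the kernel of a surjective one factors through it. -/
lemma exists_comp_eq_of_surjective [NonUnitalCStarAlgebra D] (π : A →⋆ₙₐ[ℂ] B) (ψ : A →⋆ₙₐ[ℂ] D)
    (hπ : Function.Surjective π) (h : ∀ a, π a = 0 → ψ a = 0) :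
    ∃ χ : B →⋆ₙₐ[ℂ] D, ∀ a, χ (π a) = ψ a := by
  choose g hg using hπ
  have hf : ∀ a, ψ (g (π a)) = ψ a := fun a ↦ by
    rw [← sub_eq_zero, ← map_sub]
    exact h _ (by rw [map_sub, hg, sub_self])
  have hs : ∀ b, ∃ a, π a = b := fun b ↦ ⟨g b, hg b⟩
  exact ⟨{
    toFun := fun b ↦ ψ (g b)
    map_smul' := fun c x ↦ by
      obtain ⟨x, rfl⟩ := hs x
      rw [← map_smul, hf, hf, map_smul]; rfl
    map_zero' := by rw [← map_zero π, hf, map_zero]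
    map_add' := fun x y ↦ by
      obtain ⟨x, rfl⟩ := hs x
      obtain ⟨y, rfl⟩ := hs y
      rw [← map_add, hf, hf, hf, map_add]
    map_mul' := fun x y ↦ by
      obtain ⟨x, rfl⟩ := hs x
      obtain ⟨y, rfl⟩ := hs y
      rw [← map_mul, hf, hf, hf, map_mul]
    map_star' := fun x ↦ by
      obtain ⟨x, rfl⟩ := hs x
      rw [← map_star, hf, hf, map_star] }, hf⟩

lemma continuous_of_cstar (σ : A →⋆ₙₐ[ℂ] B) : Continuous σ :=
  AddMonoidHomClass.continuous_of_bound σ 1 fun a ↦ by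
    rw [one_mul]
    exact NonUnitalStarAlgHom.norm_apply_le σ a

/-- The range of an injective star homomorphism of C⋆-algebras is closed. -/
lemma isClosed_range_of_injective (φ : B →⋆ₙₐ[ℂ] A) (hφ : Function.Injective φ) :
    IsClosed (Set.range φ) :=
  (NonUnitalStarAlgHom.isometry φ hφ).isClosedEmbedding.isClosed_range

end NonUnitalStarAlgHom

/-! ### Transfer of membership along embeddings -/

namespace CStarClass.UpwardsDirected

variable {𝒞 : CStarClass.{u}} {A B : Type u} [NonUnitalCStarAlgebra A] [NonUnitalCStarAlgebra B]

/-- An injective star homomorphism is isometric, so its range is a closed subalgebra isomorphic to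
the domain. This is the form in which upwards directedness is used everywhere below. -/
lemma of_injective (h𝒞 : 𝒞.UpwardsDirected) (φ : B →⋆ₙₐ[ℂ] A) (hφ : Function.Injective φ)
    (hB : 𝒞 B) : 𝒞 A := by
  refine h𝒞 A B (NonUnitalStarAlgHom.range φ) ?_ ⟨StarAlgEquiv.ofInjective' φ hφ⟩ hB
  exact φ.isClosed_range_of_injective hφ

/-- The inverse of `ψ` on its range is again an embedding, into `B`; with `of_injective` this makes
membership invariant under isomorphism. -/
lemma of_range (h𝒞 : 𝒞.UpwardsDirected) (ψ : B →⋆ₙₐ[ℂ] A) (hψ : Function.Injective ψ)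
    [IsClosed (NonUnitalStarAlgHom.range ψ : Set A)] (h : 𝒞 (NonUnitalStarAlgHom.range ψ)) :
    𝒞 B := by
  obtain ⟨χ, hχ⟩ := ψ.exists_comp_eq_of_injective
    (NonUnitalStarSubalgebraClass.subtype (NonUnitalStarAlgHom.range ψ) :
      NonUnitalStarAlgHom.range ψ →⋆ₙₐ[ℂ] A) hψ fun d ↦ d.2
  refine h𝒞.of_injective χ (fun x y hxy ↦ Subtype.ext ?_) h
  exact (hχ x).symm.trans ((congrArg ψ hxy).trans (hχ y))

/-- If `φ : F → A` is an injective star homomorphism, `F` is hereditarily in `𝒞`, and `D` is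
a nonzero closed subalgebra of `φ F` with `D (φ F) D ⊆ D`, then `D` is in `𝒞`. -/
lemma of_hereditarilyIn (h𝒞 : 𝒞.UpwardsDirected) {F : Type u} [NonUnitalCStarAlgebra F]
    (hF : HereditarilyIn 𝒞 F) (φ : F →⋆ₙₐ[ℂ] A) (hφ : Function.Injective φ)
    (D : NonUnitalStarSubalgebra ℂ A) [hD : IsClosed (D : Set A)] (hD0 : D ≠ ⊥)
    (hr : ∀ d ∈ D, ∃ f, φ f = d) (hm : ∀ b ∈ D, ∀ f : F, ∀ c ∈ D, b * φ f * c ∈ D) : 𝒞 D := by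
  have hcl : IsClosed ((D.comap φ : NonUnitalStarSubalgebra ℂ F) : Set F) :=
    hD.preimage (NonUnitalStarAlgHom.isometry φ hφ).continuous
  -- The preimage of `D` is a nonzero hereditary subalgebra of `F`, and `φ` embeds it into `D`.
  have h1 : 𝒞 (D.comap φ : NonUnitalStarSubalgebra ℂ F) := by
    refine hF _ (.of_mul_mul_mem hcl fun b hb a c hc ↦ ?_) ?_
    · rw [NonUnitalStarSubalgebra.mem_comap] at *
      rw [map_mul, map_mul]
      exact hm _ hb _ _ hc
    · contrapose! hD0
      rw [eq_bot_iff]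
      intro d hd
      obtain ⟨f, rfl⟩ := hr d hd
      have : f ∈ (D.comap φ : NonUnitalStarSubalgebra ℂ F) := hd
      rw [hD0, NonUnitalStarAlgebra.mem_bot] at this
      rw [this, map_zero]
      exact zero_mem _
  let ψ : (D.comap φ : NonUnitalStarSubalgebra ℂ F) →⋆ₙₐ[ℂ] A :=
    φ.comp (NonUnitalStarSubalgebraClass.subtype _)
  refine h𝒞.of_injective (NonUnitalStarAlgHom.codRestrict ψ D fun x ↦ x.2) ?_ h1
  intro x y hxy
  exact Subtype.ext (hφ (congrArg Subtype.val hxy))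

end CStarClass.UpwardsDirected

/-! ### Hereditary subalgebras and fixed points of an involutive automorphism -/

section Involution

variable {A : Type u} [NonUnitalCStarAlgebra A]

/-- The two sides have opposite signs, so both vanish. -/
lemma eq_zero_of_star_mul_self_eq_neg {a b : A} (h : star a * a = -(star b * b)) :
    a = 0 ∧ b = 0 := by
  let _ : PartialOrder A := CStarAlgebra.spectralOrder A
  have _ : StarOrderedRing A := CStarAlgebra.spectralOrderedRing A
  have h1 : star a * a = 0 := by
    refine le_antisymm ?_ (star_mul_self_nonneg a)
    rw [h, neg_nonpos]
    exact star_mul_self_nonneg b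
  refine ⟨CStarRing.star_mul_self_eq_zero_iff _ |>.1 h1, ?_⟩
  rw [h1, eq_comm, neg_eq_zero] at h
  exact CStarRing.star_mul_self_eq_zero_iff _ |>.1 h

lemma quasispectrum_mul_star_self_nonneg (y : A) : ∀ x ∈ quasispectrum ℝ (y * star y), 0 ≤ x := by
  let _ : PartialOrder A := CStarAlgebra.spectralOrder A
  have _ : StarOrderedRing A := CStarAlgebra.spectralOrderedRing A
  exact quasispectrum_nonneg_of_nonneg _ (mul_star_self_nonneg y)

/-- `(y⋆ y)^(1/2) y⋆ = y⋆ (y y⋆)^(1/2)`. -/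
lemma sqrt_mul_star_eq {y s t r q : A} (hr : star r = r) (hq : star q = q) (hs : r * r = s)
    (ht : q * q = t) (hss : s * s = y * star y) (htt : t * t = star y * y)
    (hc : ∀ z : A, Commute s z → Commute r z) : t * star y = star y * s := by
  have hs' : star s = s := by rw [← hs, star_mul, hr]
  have ht' : star t = t := by rw [← ht, star_mul, hq]
  set x := t * star y - star y * s with hx
  have h1 : t * x = -(x * s) := by
    have h2 : t * x + x * s = t * t * star y - star y * (s * s) := by
      rw [hx]
      noncomm_ring
    rw [eq_neg_iff_add_eq_zero, h2, hss, htt]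
    noncomm_ring
  have h1' : star x * t = -(s * star x) := by
    have := congrArg star h1
    rwa [star_mul, star_neg, star_mul, hs', ht'] at this
  have h2 : Commute s (star x * x) := by
    change s * (star x * x) = star x * x * s
    have h3 : s * star x = -(star x * t) := by rw [h1', neg_neg]
    have h4 : x * s = -(t * x) := by rw [h1, neg_neg]
    rw [← mul_assoc, h3, mul_assoc, h4]
    noncomm_ring
  have h3 : star (q * x) * (q * x) = -(star (x * r) * (x * r)) := by
    have h4 : star (x * r) * (x * r) = star x * (x * s) := by
      rw [star_mul, hr, ← hs, mul_assoc, ← mul_assoc _ x r, ← mul_assoc r, (hc _ h2).eq]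
      simp only [mul_assoc]
    have h5 : star (q * x) * (q * x) = star x * (t * x) := by
      rw [star_mul, hq, ← ht]
      simp only [mul_assoc]
    rw [h4, h5, h1, mul_neg]
  have h4 : x * s = 0 := by
    rw [← hs, ← mul_assoc, (eq_zero_of_star_mul_self_eq_neg h3).2, zero_mul]
  have h5 : x * y = 0 := by
    rw [← CStarRing.mul_star_self_eq_zero_iff, star_mul, ← mul_assoc, mul_assoc x, ← hss,
      ← mul_assoc, h4, zero_mul, zero_mul]
  -- Now `x s = 0` and `x y = 0`, while `x⋆ = y t - s y`.
  have h6 : x * star x = 0 := by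
    have h7 : star x = y * t - s * y := by
      rw [hx, star_sub, star_mul, star_mul, star_star, hs', ht']
    rw [h7, mul_sub, ← mul_assoc, ← mul_assoc, h5, h4, zero_mul, zero_mul, sub_zero]
  exact sub_eq_zero.1 ((CStarRing.mul_star_self_eq_zero_iff _).1 h6)

variable {B : NonUnitalStarSubalgebra ℂ A} {σ : A →⋆ₙₐ[ℂ] A}

lemma cfcₙ_sqrt_mul_self (y : A) :
    cfcₙ Real.sqrt (y * star y) * cfcₙ Real.sqrt (y * star y) = y * star y := by
  have hsa : IsSelfAdjoint (y * star y) := .mul_star_self y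
  rw [← cfcₙ_mul Real.sqrt Real.sqrt (y * star y)]
  conv_rhs => rw [← cfcₙ_id' ℝ (y * star y)]
  exact cfcₙ_congr fun t ht ↦ Real.mul_self_sqrt (quasispectrum_mul_star_self_nonneg y t ht)

/-- An element `y ∈ B A` with `σ y = y⋆` yields a nonzero `c` with `c c⋆` fixed by `σ` and
`c⋆ A c ⊆ B`. -/
lemma exists_fixed_mul_star (hB : IsHereditarySubalgebra B) {y b m : A} (hb : b ∈ B)
    (hy : y = b * m) (hyB : y * star y ∈ B) (hσy : σ y = star y) (hy0 : y ≠ 0) :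
    ∃ c : A, c ≠ 0 ∧ (∀ x, star c * x * c ∈ B) ∧ σ (c * star c) = c * star c := by
  have : IsClosed (B : Set A) := hB.isClosed
  set s := cfcₙ Real.sqrt (y * star y) with hs
  have hs' : star s = s := (cfcₙ_predicate (p := IsSelfAdjoint) Real.sqrt _).star_eq
  have hss : s * s = y * star y := cfcₙ_sqrt_mul_self y
  have hsB : s ∈ B := cfcₙ_mem (𝕜' := ℂ) _ hyB
  obtain ⟨r, hr, hrr, hrc⟩ : ∃ r, star r = r ∧ r * r = s ∧ ∀ z, Commute s z → Commute r z := by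
    have hnn : ∀ x ∈ quasispectrum ℝ s, 0 ≤ x := by
      let _ : PartialOrder A := CStarAlgebra.spectralOrder A
      have _ : StarOrderedRing A := CStarAlgebra.spectralOrderedRing A
      exact quasispectrum_nonneg_of_nonneg _ (cfcₙ_nonneg fun x _ ↦ Real.sqrt_nonneg x)
    have hsa : IsSelfAdjoint s := hs'
    refine ⟨cfcₙ Real.sqrt s, (cfcₙ_predicate (p := IsSelfAdjoint) Real.sqrt _).star_eq, ?_,
      fun z hz ↦ hz.cfcₙ_real _⟩
    rw [← cfcₙ_mul Real.sqrt Real.sqrt s]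
    conv_rhs => rw [← cfcₙ_id' ℝ s]
    exact cfcₙ_congr fun t ht ↦ Real.mul_self_sqrt (hnn t ht)
  have hσy' : σ (star y) = y := by rw [map_star, hσy, star_star]
  -- As `σ (y y⋆) = y⋆ y`, the element `σ s` is the square root of `y⋆ y`.
  have key : σ s * star y = star y * s := by
    refine sqrt_mul_star_eq (q := σ r) hr (by rw [← map_star, hr]) hrr (by rw [← map_mul, hrr]) hss
      ?_ hrc
    rw [← map_mul, hss, map_mul, hσy, hσy']
  have key' : y * σ s = s * y := by
    have := congrArg star key
    rwa [star_mul, star_mul, star_star, ← map_star, hs'] at this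
  -- Stated for a general `n` so that it serves both `y` and `-y`. In the expansion of `(s + n⋆) (s
  -- + n)`, σ exchanges `s s` with `n⋆ n` and `s n` with `n⋆ s`.
  have hc : ∀ n m' : A, n = b * m' → σ n = star n → s * s = n * star n →
      σ s * star n = star n * s → n * σ s = s * n →
      (∀ x, star (s + star n) * x * (s + star n) ∈ B) ∧
      σ ((s + star n) * star (s + star n)) = (s + star n) * star (s + star n) := by
    intro n m' hn h1 h2 h3 h4
    have h1' : σ (star n) = n := by rw [map_star, h1, star_star]
    constructor
    · intro x
      have h5 : star (s + star n) * x * (s + star n) = s * x * s + s * (x * star m') * star b +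
          (b * (m' * x) * s + b * (m' * x * star m') * star b) := by
        rw [star_add, star_star, hs', hn, star_mul]
        noncomm_ring
      rw [h5]
      exact add_mem (add_mem (hB.mul_mul_mem hsB _ hsB) (hB.mul_mul_mem hsB _ (star_mem hb)))
        (add_mem (hB.mul_mul_mem hb _ hsB) (hB.mul_mul_mem hb _ (star_mem hb)))
    · have h6 : σ s * σ s = star n * n := by rw [← map_mul, h2, map_mul, h1, h1']
      have h7 : (s + star n) * star (s + star n) = s * s + s * n + star n * s + star n * n := by
        rw [star_add, star_star, hs']
        noncomm_ring
      rw [h7, map_add, map_add, map_add, map_mul σ s s, map_mul σ s n, map_mul σ (star n) s,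
        map_mul σ (star n) n, h1, h1', h6, h3, h4, h2]
      abel
  -- The elements `s + y⋆` and `s - y⋆` cannot both vanish, since their difference is `2 y⋆`.
  by_cases h0 : s + star y = 0
  · refine ⟨s + star (-y), fun h1 ↦ hy0 ?_, hc (-y) (-m) (by rw [hy, mul_neg]) ?_ ?_ ?_ ?_⟩
    · have : (2 : ℝ) • star y = 0 := by
        rw [← sub_eq_zero.2 (h0.trans h1.symm), star_neg]
        module
      simpa using this
    · rw [map_neg, hσy, star_neg]
    · rw [hss, star_neg, neg_mul_neg]
    · rw [star_neg, mul_neg, key, neg_mul]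
    · rw [neg_mul, key', mul_neg]
  · exact ⟨_, h0, hc y m hy hσy hss key key'⟩

/-- The elements of `F` whose image under `φ` is fixed by left and right multiplication with the
self-adjoint element `p`. -/
def NonUnitalStarAlgHom.fixedBy {F : Type u} [NonUnitalCStarAlgebra F] (φ : F →⋆ₙₐ[ℂ] A) (p : A)
    (hp : star p = p) : NonUnitalStarSubalgebra ℂ F where
  carrier := {f | φ f * p = φ f ∧ p * φ f = φ f}
  add_mem' {a b} ha hb := by
    constructor
    · rw [map_add, add_mul, ha.1, hb.1]
    · rw [map_add, mul_add, ha.2, hb.2]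
  zero_mem' := by simp
  mul_mem' {a b} ha hb := by
    constructor
    · rw [map_mul, mul_assoc, hb.1]
    · rw [map_mul, ← mul_assoc, ha.2]
  smul_mem' c x hx := by
    constructor
    · rw [map_smul, smul_mul_assoc, hx.1]
    · rw [map_smul, mul_smul_comm, hx.2]
  star_mem' {x} hx := by
    constructor
    · rw [map_star, ← hp, ← star_mul, hx.2]
    · rw [map_star, ← hp, ← star_mul, hx.1]

variable {𝒞 : CStarClass.{u}} {F : Type u} [NonUnitalCStarAlgebra F] {φ : F →⋆ₙₐ[ℂ] A}

/-- If `c ≠ 0`, `c⋆ A c ⊆ B` and `c c⋆` is fixed by `σ`, then `B` contains a copy of a nonzero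
hereditary subalgebra of the fixed point algebra of `σ`. -/
lemma CStarClass.UpwardsDirected.of_fixed_mul_star (h𝒞 : 𝒞.UpwardsDirected)
    (hφ : Function.Injective φ) (hφσ : ∀ a, σ a = a → ∃ f, φ f = a) (hF : HereditarilyIn 𝒞 F)
    [IsClosed (B : Set A)] {c : A} (hc0 : c ≠ 0) (hcB : ∀ x, star c * x * c ∈ B)
    (hcσ : σ (c * star c) = c * star c) : 𝒞 B := by
  set h := c * star c with hh
  have hsa : IsSelfAdjoint h := .mul_star_self c
  have hh0 : 0 < ‖h‖ := by
    rw [norm_pos_iff, hh, ne_eq, CStarRing.mul_star_self_eq_zero_iff]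
    exact hc0
  set δ : ℝ := ‖h‖ / 2 with hδ
  have hδ0 : 0 < δ := by positivity
  have hmax : ∀ t : ℝ, 0 < max t δ := fun t ↦ lt_max_of_lt_right hδ0
  -- A continuous function vanishing at `0` and equal to `t^(-1/2)` for `t ≥ δ`. Thus `k(t) t k(t) =
  -- 1` on the support of `e`, and `p = k(h) h k(h)` acts as a unit on `e(h) = (h - δ)₊`, though it
  -- need not be a projection.
  let k : ℝ → ℝ := fun t ↦ √(t ^ 2 / (max t δ) ^ 3)
  have hk : Continuous k := by
    refine Real.continuous_sqrt.comp (.div (by fun_prop) (by fun_prop) fun t ↦ ?_)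
    exact (pow_pos (hmax t) 3).ne'
  have hk0 : k 0 = 0 := by simp [k]
  let e : ℝ → ℝ := fun t ↦ max (t - δ) 0
  have he : Continuous e := by fun_prop
  have he0 : e 0 = 0 := by simp [e, hδ0.le]
  have hke : ∀ t, e t * (k t * t * k t) = e t := by
    intro t
    rcases le_total t δ with ht | ht
    · have : e t = 0 := by simp [e, ht]
      rw [this, zero_mul]
    · have h1 : k t * t * k t = 1 := by
        have ht0 : 0 < t := hδ0.trans_le ht
        have : k t * t * k t = t * (k t * k t) := by ring
        rw [this, Real.mul_self_sqrt (by positivity), max_eq_left ht]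
        field_simp
      rw [h1, mul_one]
  set kh := cfcₙ k h with hkh
  have hkh' : star kh = kh := (cfcₙ_predicate (p := IsSelfAdjoint) k h).star_eq
  set w := kh * c with hw
  set p := w * star w with hp
  have hp' : star p = p := by rw [hp, star_mul, star_star]
  have hpk : p = cfcₙ (fun t ↦ k t * t * k t) h := by
    rw [cfcₙ_mul (fun t ↦ k t * t) k h (by fun_prop) (by simp) (by fun_prop) hk0,
      cfcₙ_mul k (fun t ↦ t) h (by fun_prop) hk0, cfcₙ_id' ℝ h, hp, hw, star_mul, hkh', hh]
    simp only [mul_assoc]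
    rfl
  have hep : cfcₙ e h * p = cfcₙ e h := by
    rw [hpk, ← cfcₙ_mul e (fun t ↦ k t * t * k t) h (by fun_prop) he0 (by fun_prop) (by simp)]
    exact congrArg (cfcₙ · h) (funext hke)
  -- If `(h - δ)₊` vanished, `h` would equal `min(h, δ)` and have norm at most `‖h‖ / 2`.
  have heh : cfcₙ e h ≠ 0 := by
    intro h0
    have h1 : h = cfcₙ (fun t ↦ min t δ) h := by
      have h2 : cfcₙ (fun t ↦ e t + min t δ) h = cfcₙ e h + cfcₙ (fun t ↦ min t δ) h :=
        cfcₙ_add e (fun t ↦ min t δ) h (by fun_prop) he0 (by fun_prop) (by simp [hδ0.le])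
      rw [h0, zero_add] at h2
      rw [← h2]
      conv_lhs => rw [← cfcₙ_id' ℝ h]
      refine congrArg (cfcₙ · h) (funext fun t ↦ ?_)
      rcases le_total t δ with ht | ht <;> simp [e, ht]
    have h2 : ‖h‖ ≤ δ := by
      rw [h1]
      refine norm_cfcₙ_le fun t ht ↦ ?_
      have ht0 : 0 ≤ t := quasispectrum_mul_star_self_nonneg c t ht
      rw [Real.norm_of_nonneg (le_min ht0 hδ0.le)]
      exact min_le_right _ _
    linarith
  have hσe : σ (cfcₙ e h) = cfcₙ e h := by
    rw [NonUnitalStarAlgHom.map_cfcₙ σ e h (by fun_prop) he0 σ.continuous_of_cstar hsa (by rw [hcσ]; exact hsa),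
      hcσ]
  have hφc : Continuous φ := (NonUnitalStarAlgHom.isometry φ hφ).continuous
  -- Hereditary in `F`, and nonzero because it contains the preimage of the σ-fixed element `e(h)`.
  let D := φ.fixedBy p hp'
  have hDcl : IsClosed (D : Set F) :=
    (isClosed_eq (hφc.mul continuous_const) hφc).inter
      (isClosed_eq (continuous_const.mul hφc) hφc)
  have hD : 𝒞 D := by
    refine hF D (.of_mul_mul_mem hDcl fun x hx a y hy ↦ ⟨?_, ?_⟩) ?_
    · rw [map_mul, mul_assoc, hy.1]
    · rw [map_mul, map_mul, ← mul_assoc, ← mul_assoc, hx.2]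
    · intro hbot
      obtain ⟨f, hf⟩ := hφσ _ hσe
      have hfD : f ∈ D := by
        constructor
        · rw [hf, hep]
        · have := congrArg star hep
          rw [star_mul, hp', (cfcₙ_predicate (p := IsSelfAdjoint) e h).star_eq] at this
          rw [hf, this]
      rw [hbot, NonUnitalStarAlgebra.mem_bot] at hfD
      rw [hfD, map_zero] at hf
      exact heh hf.symm
  -- Multiplicative because `w w⋆ = p` is a unit for `φ D`; injective because `w (w⋆ x w) w⋆ = p x p
  -- = x` there. The values lie in `B` since `w = k(h) c` and `c⋆ A c ⊆ B`.
  let χ : D →⋆ₙₐ[ℂ] A :=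
    { toFun := fun f ↦ star w * φ f * w
      map_smul' := fun t x ↦ by
        change star w * φ (t • (x : F)) * w = t • (star w * φ x * w)
        rw [map_smul, mul_smul_comm, smul_mul_assoc]
      map_zero' := by
        change star w * φ 0 * w = 0
        rw [map_zero, mul_zero, zero_mul]
      map_add' := fun x y ↦ by
        change star w * φ ((x : F) + y) * w = _
        rw [map_add, mul_add, add_mul]
      map_mul' := fun x y ↦ by
        change star w * φ ((x : F) * y) * w = _
        have h1 : star w * φ x * w * (star w * φ y * w) = star w * (φ x * p * φ y) * w := by
          rw [hp]
          simp only [mul_assoc]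
        rw [h1, x.2.1, map_mul]
      map_star' := fun x ↦ by
        change star w * φ (star (x : F)) * w = _
        rw [star_mul _ w, star_mul _ (φ x), star_star, map_star, mul_assoc] }
  have hχB : ∀ x, χ x ∈ B := fun x ↦ by
    change star w * φ x * w ∈ B
    have : star w * φ x * w = star c * (kh * φ x * kh) * c := by
      rw [hw, star_mul, hkh']
      simp only [mul_assoc]
    rw [this]
    exact hcB _
  have hχinj : Function.Injective χ := by
    rw [injective_iff_map_eq_zero]
    intro x hx
    have hx' : star w * φ x * w = 0 := hx
    have h1 : p * φ x * p = 0 := by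
      have : p * φ x * p = w * (star w * φ x * w) * star w := by
        rw [hp]
        simp only [mul_assoc]
      rw [this, hx', mul_zero, zero_mul]
    rw [x.2.2, x.2.1] at h1
    exact Subtype.ext (hφ (h1.trans (map_zero φ).symm))
  exact h𝒞.of_injective (NonUnitalStarAlgHom.codRestrict χ B hχB)
    (fun x y hxy ↦ hχinj (congrArg Subtype.val hxy)) hD

/-- If `B (σ B) = 0` then `B` is isomorphic to a hereditary subalgebra of the fixed point algebra
of `σ`. -/
lemma CStarClass.UpwardsDirected.of_mul_map_eq_zero (h𝒞 : 𝒞.UpwardsDirected)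
    (hσ : ∀ a, σ (σ a) = a) (hφ : Function.Injective φ) (hφσ : ∀ a, σ a = a ↔ ∃ f, φ f = a)
    (hF : HereditarilyIn 𝒞 F) (hB : IsHereditarySubalgebra B) [IsClosed (B : Set A)] (hB0 : B ≠ ⊥)
    (h0 : ∀ b ∈ B, ∀ a, ∀ c ∈ B, b * a * σ c = 0) : 𝒞 B := by
  -- Without a unit in `A`, the middle factor for `h0` is found inside `(b σ c) (b σ c)⋆`, which
  -- begins with `b (σ c) σ(c⋆)`.
  have h2 : ∀ b ∈ B, ∀ c ∈ B, b * σ c = 0 := fun b hb c hc ↦ by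
    rw [← CStarRing.mul_star_self_eq_zero_iff, star_mul, ← map_star, ← mul_assoc, mul_assoc b,
      ← map_mul, map_mul, ← mul_assoc, h0 b hb _ _ (star_mem hc), zero_mul]
  have h3 : ∀ b ∈ B, ∀ c ∈ B, σ b * c = 0 := fun b hb c hc ↦ by
    have := congrArg σ (h2 b hb c hc)
    rwa [map_mul, hσ, map_zero] at this
  have h4 : ∀ b ∈ B, ∀ a, ∀ c ∈ B, σ b * a * c = 0 := fun b hb a c hc ↦ by
    have := congrArg σ (h0 b hb (σ a) c hc)
    rwa [map_mul, map_mul, hσ, hσ, map_zero] at this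
  -- The cross terms of `(x + σ x) (y + σ y)` vanish by `h2` and `h3`.
  let ψ : B →⋆ₙₐ[ℂ] A :=
    { toFun := fun b ↦ b + σ b
      map_smul' := fun t x ↦ by
        change t • (x : A) + σ (t • (x : A)) = t • ((x : A) + σ x)
        rw [map_smul, smul_add]
      map_zero' := by
        change (0 : A) + σ 0 = 0
        rw [map_zero, zero_add]
      map_add' := fun x y ↦ by
        change ((x : A) + y) + σ ((x : A) + y) = _
        rw [map_add]
        abel
      map_mul' := fun x y ↦ by
        change (x : A) * y + σ ((x : A) * y) = (x + σ x) * (y + σ y)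
        rw [mul_add, add_mul, add_mul, h2 x x.2 y y.2, h3 x x.2 y y.2, map_mul]
        abel
      map_star' := fun x ↦ by
        change star (x : A) + σ (star (x : A)) = star (x + σ x)
        rw [star_add, map_star] }
  have hψ : ∀ b, ψ b = b + σ b := fun _ ↦ rfl
  have hψinj : Function.Injective ψ := by
    rw [injective_iff_map_eq_zero]
    intro x hx
    rw [hψ] at hx
    have h5 : (x : A) * star (x : A) = 0 := by
      have := congrArg (· * star (x : A)) hx
      simpa only [add_mul, h3 x x.2 _ (star_mem x.2), add_zero, zero_mul] using this
    exact Subtype.ext ((CStarRing.mul_star_self_eq_zero_iff _).1 h5)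
  let D : NonUnitalStarSubalgebra ℂ A := NonUnitalStarAlgHom.range ψ
  have hDcl : IsClosed (D : Set A) := ψ.isClosed_range_of_injective hψinj
  have hD : 𝒞 D := by
    refine h𝒞.of_hereditarilyIn hF φ hφ D ?_ ?_ ?_
    · contrapose! hB0
      rw [eq_bot_iff]
      intro b hb
      have : ψ ⟨b, hb⟩ ∈ D := ⟨_, rfl⟩
      rw [hB0, NonUnitalStarAlgebra.mem_bot] at this
      rw [NonUnitalStarAlgebra.mem_bot]
      exact congrArg Subtype.val (hψinj (this.trans (map_zero ψ).symm))
    · rintro _ ⟨b, rfl⟩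
      refine (hφσ _).1 ?_
      change σ (b + σ b) = b + σ b
      rw [map_add, hσ, add_comm]
    -- For fixed `f`, `(b + σ b) f (c + σ c) = b f c + σ (b f c)`, the image of `b f c ∈ B`.
    · rintro _ ⟨b, rfl⟩ f _ ⟨c, rfl⟩
      refine ⟨⟨b * φ f * c, hB.mul_mul_mem b.2 _ c.2⟩, ?_⟩
      change (b : A) * φ f * c + σ (b * φ f * c) = (b + σ b) * φ f * (c + σ c)
      have h5 : σ (φ f) = φ f := (hφσ _).2 ⟨f, rfl⟩
      rw [add_mul, add_mul, mul_add, mul_add, h0 _ b.2 _ _ c.2, h4 _ b.2 _ _ c.2, map_mul, map_mul,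
        h5]
      abel
  exact h𝒞.of_range ψ hψinj hD

/-- If the fixed point algebra of an involutive automorphism of `A` is hereditarily in `𝒞`, then
`A` is hereditarily in `𝒞`. -/
theorem HereditarilyIn.of_fixedPoints (h𝒞 : 𝒞.UpwardsDirected)
    (hσ : ∀ a, σ (σ a) = a) (hφ : Function.Injective φ) (hφσ : ∀ a, σ a = a ↔ ∃ f, φ f = a)
    (hF : HereditarilyIn 𝒞 F) : HereditarilyIn 𝒞 A := by
  intro B hB hB0
  have hcl : IsClosed (B : Set A) := hB.isClosed
  by_cases h0 : ∀ b ∈ B, ∀ a, b * a * σ (star b) = 0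
  -- The hypothesis is sesquilinear in `b`; polarizing with `b + c⋆` and `b + i c⋆` gives `b a σ(c)
  -- = 0`.
  · refine h𝒞.of_mul_map_eq_zero hσ hφ hφσ hF hB hB0 fun b hb a c hc ↦ ?_
    have hc' : star c ∈ B := star_mem hc
    have h1 := h0 _ (add_mem hb hc') a
    have h2 := h0 _ (add_mem hb (SMulMemClass.smul_mem Complex.I hc')) a
    have h3 := h0 b hb a
    have h4 := h0 _ hc' a
    rw [star_star] at h4
    have h5 : star c * a * σ (star b) + b * a * σ c = 0 := by
      simpa only [star_add, star_star, map_add, add_mul, mul_add, h3, h4, zero_add, add_zero]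
        using h1
    have h6 : Complex.I • (star c * a * σ (star b)) + -Complex.I • (b * a * σ c) = 0 := by
      simpa only [star_add, star_smul, star_star, map_add, map_smul, add_mul, mul_add,
        smul_mul_assoc, mul_smul_comm, Complex.star_def, Complex.conj_I, h3, h4, smul_zero,
        zero_add, add_zero] using h2
    have h7 : (2 : ℂ) • (b * a * σ c) = (star c * a * σ (star b) + b * a * σ c) +
        Complex.I • (Complex.I • (star c * a * σ (star b)) + -Complex.I • (b * a * σ c)) := by
      match_scalars <;> simp
      norm_num
    rw [h5, h6, smul_zero, add_zero] at h7
    simpa using h7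
  -- The conjugate-linear involution `a ↦ σ (a⋆)` has fixed points spanning `A`: use `a + σ (a⋆)`
  -- and `i (a - σ (a⋆))`. The choice of `m` among them makes `σ y = y⋆` for `y = b m σ(b⋆)`.
  · obtain ⟨b, hb, m, hσm, hm⟩ : ∃ b ∈ B, ∃ m, σ (star m) = m ∧ b * m * σ (star b) ≠ 0 := by
      contrapose! h0
      intro b hb a
      have h1 := h0 b hb (a + σ (star a)) (by
        rw [star_add, map_add, ← map_star, hσ, star_star, add_comm])
      have h2 := h0 b hb (Complex.I • (a - σ (star a))) (by
        rw [star_smul, star_sub, map_smul, map_sub, ← map_star, hσ, star_star, Complex.star_def,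
          Complex.conj_I, neg_smul, ← smul_neg, neg_sub])
      have h3 : (2 : ℂ) • a = (a + σ (star a)) -
          Complex.I • (Complex.I • (a - σ (star a))) := by
        rw [smul_smul, Complex.I_mul_I]
        module
      have h4 : (2 : ℂ) • (b * a * σ (star b)) = 0 := by
        rw [← smul_mul_assoc, ← mul_smul_comm, h3, mul_sub, sub_mul, h1, mul_smul_comm,
          smul_mul_assoc, h2, smul_zero, sub_zero]
      simpa using h4
    have hσm' : σ m = star m := by rw [← hσm, hσ, hσm]
    have hyB : b * m * σ (star b) * star (b * m * σ (star b)) ∈ B := by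
      have : b * m * σ (star b) * star (b * m * σ (star b)) =
          b * (m * σ (star b) * star (m * σ (star b))) * star b := by
        simp only [star_mul, mul_assoc]
      rw [this]
      exact hB.mul_mul_mem hb _ (star_mem hb)
    obtain ⟨c, hc0, hcB, hcσ⟩ := exists_fixed_mul_star (σ := σ) hB hb (mul_assoc b m _) hyB (by
      rw [map_mul, map_mul, hσ, hσm', star_mul, star_mul, map_star, star_star, mul_assoc]) hm
    exact h𝒞.of_fixed_mul_star hφ (fun a ↦ (hφσ a).1) hF hc0 hcB hcσ

end Involution

/-! ### Ideals and quotients -/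

namespace CStarIdeal

variable {A : Type u} [NonUnitalCStarAlgebra A]

/-- The quotient map as a star homomorphism. -/
def mkHom (I : CStarIdeal A) : A →⋆ₙₐ[ℂ] I.Quotient where
  toFun := Quotient.mk I
  map_smul' := Quotient.mk_smul I
  map_zero' := Quotient.mk_zero I
  map_add' := Quotient.mk_add I
  map_mul' := Quotient.mk_mul I
  map_star' := Quotient.mk_star I

lemma mkHom_surjective (I : CStarIdeal A) : Function.Surjective I.mkHom := Quotient.mk_surjective I

lemma mkHom_eq_zero (I : CStarIdeal A) {a : A} : I.mkHom a = 0 ↔ a ∈ I.toSubmodule := by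
  rw [← map_zero I.mkHom]
  exact (Quotient.mk_eq_mk I).trans (by rw [sub_zero])

/-- The preimage of a closed ideal under a star homomorphism. -/
def comap {D : Type u} [NonUnitalCStarAlgebra D] (σ : D →⋆ₙₐ[ℂ] A) (I : CStarIdeal A) :
    CStarIdeal D where
  toSubmodule := I.toSubmodule.comap (σ : D →ₗ[ℂ] A)
  mul_mem_left' a x hx := by
    change σ (a * x) ∈ I.toSubmodule
    rw [map_mul]
    exact I.mul_mem_left' _ hx
  mul_mem_right' a x hx := by
    change σ (x * a) ∈ I.toSubmodule
    rw [map_mul]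
    exact I.mul_mem_right' _ hx
  isClosed' := I.isClosed'.preimage σ.continuous_of_cstar

lemma mem_comap {D : Type u} [NonUnitalCStarAlgebra D] {σ : D →⋆ₙₐ[ℂ] A} {I : CStarIdeal A}
    {a : D} : a ∈ (comap σ I).toSubmodule ↔ σ a ∈ I.toSubmodule := Iff.rfl

/-- The intersection of two closed ideals. -/
def inter (I J : CStarIdeal A) : CStarIdeal A where
  toSubmodule := I.toSubmodule ⊓ J.toSubmodule
  mul_mem_left' a _ hx := ⟨I.mul_mem_left' a hx.1, J.mul_mem_left' a hx.2⟩
  mul_mem_right' a _ hx := ⟨I.mul_mem_right' a hx.1, J.mul_mem_right' a hx.2⟩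
  isClosed' := I.isClosed'.inter J.isClosed'

/-- The closure of the sum of two closed ideals. -/
def closedSum (I J : CStarIdeal A) : CStarIdeal A where
  toSubmodule := (I.toSubmodule ⊔ J.toSubmodule).topologicalClosure
  mul_mem_left' a x hx := by
    refine map_mem_closure (continuous_const_mul a) hx fun y hy ↦ ?_
    obtain ⟨i, hi, j, hj, rfl⟩ := Submodule.mem_sup.1 hy
    rw [mul_add]
    exact Submodule.add_mem_sup (I.mul_mem_left' a hi) (J.mul_mem_left' a hj)
  mul_mem_right' a x hx := by
    refine map_mem_closure (f := (· * a)) (continuous_mul_const a) hx fun y hy ↦ ?_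
    obtain ⟨i, hi, j, hj, rfl⟩ := Submodule.mem_sup.1 hy
    change (i + j) * a ∈ _
    rw [add_mul]
    exact Submodule.add_mem_sup (I.mul_mem_right' a hi) (J.mul_mem_right' a hj)
  isClosed' := Submodule.isClosed_topologicalClosure _

lemma mem_closedSum {I J : CStarIdeal A} {a : A} :
    a ∈ (closedSum I J).toSubmodule ↔
      a ∈ closure ((I.toSubmodule ⊔ J.toSubmodule : Submodule ℂ A) : Set A) := Iff.rfl

/-- If `I ⊆ J`, the quotient map `A → A / J` factors through `A / I`. -/
lemma exists_factor {I J : CStarIdeal A} (h : ∀ a ∈ I.toSubmodule, a ∈ J.toSubmodule) :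
    ∃ q : I.Quotient →⋆ₙₐ[ℂ] J.Quotient, ∀ a, q (I.mkHom a) = J.mkHom a :=
  I.mkHom.exists_comp_eq_of_surjective J.mkHom I.mkHom_surjective fun a ha ↦
    J.mkHom_eq_zero.2 (h a (I.mkHom_eq_zero.1 ha))

end CStarIdeal

/-! ### From fixed point algebras to all quotients -/

section Residual

variable {𝒞 : CStarClass.{u}} {A F : Type u} [NonUnitalCStarAlgebra A] [NonUnitalCStarAlgebra F]
  {σ : A →⋆ₙₐ[ℂ] A} {φ : F →⋆ₙₐ[ℂ] A}

/-- If the fixed point algebra of `σ` is residually hereditarily in `𝒞`, then `A / J` is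
hereditarily in `𝒞` for every `σ`-invariant ideal `J`. -/
lemma ResiduallyHereditarilyIn.quotient_of_fixedPoints (h𝒞 : 𝒞.UpwardsDirected)
    (hσ : ∀ a, σ (σ a) = a) (hφσ : ∀ a, σ a = a ↔ ∃ f, φ f = a)
    (hF : ResiduallyHereditarilyIn 𝒞 F) (J : CStarIdeal A)
    (hJ : ∀ a ∈ J.toSubmodule, σ a ∈ J.toSubmodule) : HereditarilyIn 𝒞 J.Quotient := by
  obtain ⟨τ, hτ⟩ := J.mkHom.exists_comp_eq_of_surjective (J.mkHom.comp σ) J.mkHom_surjective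
    fun a ha ↦ J.mkHom_eq_zero.2 (hJ a (J.mkHom_eq_zero.1 ha))
  have hτ' : ∀ a, τ (J.mkHom a) = J.mkHom (σ a) := hτ
  obtain ⟨ψ, hψ⟩ := (J.comap φ).mkHom.exists_comp_eq_of_surjective (J.mkHom.comp φ)
    (J.comap φ).mkHom_surjective
    fun a ha ↦ J.mkHom_eq_zero.2 (CStarIdeal.mem_comap.1 ((J.comap φ).mkHom_eq_zero.1 ha))
  have hψ' : ∀ f, ψ ((J.comap φ).mkHom f) = J.mkHom (φ f) := hψ
  have hher : HereditarilyIn 𝒞 (J.comap φ).Quotient := by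
    -- If the pulled-back ideal is all of `F`, the quotient is zero and has no nonzero subalgebras.
    by_cases htop : (J.comap φ).toSubmodule = ⊤
    · intro B _ hB0
      refine absurd ?_ hB0
      rw [eq_bot_iff]
      intro b _
      obtain ⟨f, rfl⟩ := (J.comap φ).mkHom_surjective b
      have : (J.comap φ).mkHom f = 0 := (J.comap φ).mkHom_eq_zero.2 (htop ▸ Submodule.mem_top)
      rw [this]
      exact zero_mem _
    · exact hF _ htop
  refine HereditarilyIn.of_fixedPoints (σ := τ) (φ := ψ) h𝒞 ?_ ?_ ?_ hher
  · intro x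
    obtain ⟨a, rfl⟩ := J.mkHom_surjective x
    rw [hτ', hτ', hσ]
  · rw [injective_iff_map_eq_zero]
    intro x hx
    obtain ⟨f, rfl⟩ := (J.comap φ).mkHom_surjective x
    rw [hψ', J.mkHom_eq_zero] at hx
    exact (J.comap φ).mkHom_eq_zero.2 hx
  · intro x
    constructor
    · intro hx
      obtain ⟨a, rfl⟩ := J.mkHom_surjective x
      -- Averaging lifts a τ-fixed class to a σ-fixed element.
      obtain ⟨f, hf⟩ := (hφσ ((2⁻¹ : ℂ) • (a + σ a))).1 (by
        rw [map_smul, map_add, hσ, add_comm])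
      refine ⟨(J.comap φ).mkHom f, ?_⟩
      rw [hψ', hf, map_smul, map_add, ← hτ', hx]
      module
    · rintro ⟨y, rfl⟩
      obtain ⟨f, rfl⟩ := (J.comap φ).mkHom_surjective y
      rw [hψ', hτ', (hφσ (φ f)).2 ⟨f, rfl⟩]

/-- If the fixed point algebra of an involutive automorphism of `A` is residually hereditarily in
`𝒞`, then `A` is residually hereditarily in `𝒞`. -/
theorem ResiduallyHereditarilyIn.of_fixedPoints (h𝒞 : 𝒞.UpwardsDirected)
    (hσ : ∀ a, σ (σ a) = a) (hφσ : ∀ a, σ a = a ↔ ∃ f, φ f = a)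
    (hF : ResiduallyHereditarilyIn 𝒞 F) : ResiduallyHereditarilyIn 𝒞 A := by
  intro I _ B hB hB0
  have hBcl : IsClosed (B : Set I.Quotient) := hB.isClosed
  let I' := I.comap σ
  let J := I.inter I'
  let K := I.closedSum I'
  have hJ : HereditarilyIn 𝒞 J.Quotient := by
    refine hF.quotient_of_fixedPoints h𝒞 hσ hφσ J fun a ha ↦ ⟨ha.2, ?_⟩
    change σ (σ a) ∈ I.toSubmodule
    rw [hσ]
    exact ha.1
  have hK : HereditarilyIn 𝒞 K.Quotient := by
    refine hF.quotient_of_fixedPoints h𝒞 hσ hφσ K fun a ha ↦ ?_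
    refine map_mem_closure σ.continuous_of_cstar ha fun y hy ↦ ?_
    obtain ⟨i, hi, j, hj, rfl⟩ := Submodule.mem_sup.1 hy
    rw [map_add, add_comm]
    refine Submodule.add_mem_sup hj ?_
    change σ (σ i) ∈ I.toSubmodule
    rwa [hσ]
  obtain ⟨q, hq⟩ := CStarIdeal.exists_factor (I := J) (J := I) fun a ha ↦ ha.1
  obtain ⟨p, hp⟩ := CStarIdeal.exists_factor (I := J) (J := I') fun a ha ↦ ha.2
  obtain ⟨r, hr⟩ := CStarIdeal.exists_factor (I := I) (J := K) fun a ha ↦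
    subset_closure (Submodule.mem_sup_left ha)
  -- The part of the preimage of `B` inside `I' / J`. There `q` is injective, because its kernel `I
  -- / J` meets `I' / J` only in zero.
  let E : NonUnitalStarSubalgebra ℂ J.Quotient :=
    NonUnitalStarSubalgebra.comap q B ⊓ NonUnitalStarSubalgebra.comap p ⊥
  have hE : ∀ x, x ∈ E ↔ q x ∈ B ∧ p x = 0 := fun x ↦ by
    rw [NonUnitalStarAlgebra.mem_inf, NonUnitalStarSubalgebra.mem_comap,
      NonUnitalStarSubalgebra.mem_comap, NonUnitalStarAlgebra.mem_bot]
  by_cases hE0 : E = ⊥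
  -- When `E = 0`, `B` meets `K / I` trivially and so embeds into `A / K`.
  · let ψ : B →⋆ₙₐ[ℂ] K.Quotient := r.comp (NonUnitalStarSubalgebraClass.subtype B)
    have hψinj : Function.Injective ψ := by
      rw [injective_iff_map_eq_zero]
      rintro ⟨b, hb⟩ hx
      have hx' : r b = 0 := hx
      obtain ⟨a, rfl⟩ := I.mkHom_surjective b
      rw [hr, K.mkHom_eq_zero, CStarIdeal.mem_closedSum] at hx'
      have hsb : star (I.mkHom a) ∈ B := star_mem hb
      -- Approximate the middle `a ∈ K` by `i + j`. The class of `a⋆ j a⋆` modulo `J` lies in `E =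
      -- 0`, so `a⋆ j a⋆ ∈ I`, as is `a⋆ i a⋆`.
      have key : star a * a * star a ∈ I.toSubmodule := by
        have h1 : star a * a * star a ∈ closure (I.toSubmodule : Set A) := by
          refine map_mem_closure (f := fun x ↦ star a * x * star a) (by fun_prop) hx' fun y hy ↦ ?_
          obtain ⟨i, hi, j, hj, rfl⟩ := Submodule.mem_sup.1 hy
          have h2 : star a * j * star a ∈ I'.toSubmodule :=
            I'.mul_mem_right' _ (I'.mul_mem_left' _ hj)
          have h3 : J.mkHom (star a * j * star a) ∈ E := by
            rw [hE, hq, hp, I'.mkHom_eq_zero, map_mul, map_mul, map_star]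
            exact ⟨hB.mul_mul_mem hsb _ hsb, h2⟩
          rw [hE0, NonUnitalStarAlgebra.mem_bot, J.mkHom_eq_zero] at h3
          change star a * (i + j) * star a ∈ I.toSubmodule
          rw [mul_add, add_mul]
          exact add_mem (I.mul_mem_right' _ (I.mul_mem_left' _ hi)) h3.1
        have hIcl : IsClosed (I.toSubmodule : Set A) := I.isClosed'
        rwa [hIcl.closure_eq] at h1
      rw [← I.mkHom_eq_zero, map_mul, map_mul, map_star] at key
      set b := I.mkHom a
      have h4 : star (star b * b) * (star b * b) = 0 := by
        rw [star_mul, star_star, ← mul_assoc, key, zero_mul]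
      rw [CStarRing.star_mul_self_eq_zero_iff, CStarRing.star_mul_self_eq_zero_iff] at h4
      exact Subtype.ext h4
    have hcl : IsClosed (NonUnitalStarAlgHom.range ψ : Set K.Quotient) :=
      ψ.isClosed_range_of_injective hψinj
    refine h𝒞.of_range ψ hψinj (hK _ (.of_mul_mul_mem hcl ?_) ?_)
    · rintro _ ⟨b, rfl⟩ k _ ⟨c, rfl⟩
      obtain ⟨a, rfl⟩ := K.mkHom_surjective k
      refine ⟨⟨b * I.mkHom a * c, hB.mul_mul_mem b.2 _ c.2⟩, ?_⟩
      change r ((b : I.Quotient) * I.mkHom a * c) = r b * K.mkHom a * r c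
      rw [map_mul, map_mul, hr]
    · contrapose! hB0
      rw [eq_bot_iff]
      intro b hb
      have : ψ ⟨b, hb⟩ ∈ NonUnitalStarAlgHom.range ψ := ⟨_, rfl⟩
      rw [hB0, NonUnitalStarAlgebra.mem_bot] at this
      rw [NonUnitalStarAlgebra.mem_bot]
      exact congrArg Subtype.val (hψinj (this.trans (map_zero ψ).symm))
  -- When `E ≠ 0`, it is hereditary in `A / J`, hence in `𝒞`, and `q` embeds it into `B`.
  · have hEcl : IsClosed (E : Set J.Quotient) := by
      have : (E : Set J.Quotient) = q ⁻¹' B ∩ {x | p x = 0} := Set.ext hE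
      rw [this]
      exact (hBcl.preimage q.continuous_of_cstar).inter
        (isClosed_eq p.continuous_of_cstar continuous_const)
    have hEher : IsHereditarySubalgebra E := by
      refine .of_mul_mul_mem hEcl fun x hx a y hy ↦ ?_
      rw [hE] at *
      rw [map_mul, map_mul, map_mul, map_mul, hx.2, zero_mul, zero_mul]
      exact ⟨hB.mul_mul_mem hx.1 _ hy.1, rfl⟩
    let ψ : E →⋆ₙₐ[ℂ] I.Quotient := q.comp (NonUnitalStarSubalgebraClass.subtype E)
    refine h𝒞.of_injective (NonUnitalStarAlgHom.codRestrict ψ B fun x ↦ ((hE x).1 x.2).1) ?_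
      (hJ E hEher hE0)
    rw [injective_iff_map_eq_zero]
    rintro ⟨x, hx⟩ hx0
    have hx0' : q x = 0 := congrArg Subtype.val hx0
    have hx1 := ((hE x).1 hx).2
    obtain ⟨a, rfl⟩ := J.mkHom_surjective x
    rw [hq, I.mkHom_eq_zero] at hx0'
    rw [hp, I'.mkHom_eq_zero] at hx1
    exact Subtype.ext (J.mkHom_eq_zero.2 ⟨hx0', hx1⟩)

end Residual

/-! ### Crossed products by `ℤ/2` -/

namespace CrossedProduct

variable {A : Type u} [NonUnitalCStarAlgebra A] (α : Multiplicative (ZMod 2) →* (A ≃⋆ₐ[ℂ] A))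

/-- The sign character of `ℤ/2`. -/
def sign (g : Multiplicative (ZMod 2)) : ℂ := if g = 1 then 1 else -1

lemma sign_mul (g h : Multiplicative (ZMod 2)) : sign (g * h) = sign g * sign h := by
  have key : ∀ g h : Multiplicative (ZMod 2), (g = 1 ∧ h = 1 ∧ g * h = 1) ∨
      (g = 1 ∧ h ≠ 1 ∧ g * h ≠ 1) ∨ (g ≠ 1 ∧ h = 1 ∧ g * h ≠ 1) ∨
      (g ≠ 1 ∧ h ≠ 1 ∧ g * h = 1) := by decide
  rcases key g h with ⟨h1, h2, h3⟩ | ⟨h1, h2, h3⟩ | ⟨h1, h2, h3⟩ | ⟨h1, h2, h3⟩ <;>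
    simp [sign, h1, h2, h3]

lemma sign_inv (g : Multiplicative (ZMod 2)) : sign g⁻¹ = sign g := by
  simp only [sign, inv_eq_one]

lemma star_sign (g : Multiplicative (ZMod 2)) : star (sign g) = sign g := by
  unfold sign
  split_ifs <;> simp

lemma sign_mul_self (g : Multiplicative (ZMod 2)) : sign g * sign g = 1 := by
  unfold sign
  split_ifs <;> simp

/-- The dual action: multiplication by the sign character. -/
def dual : CrossedProduct α →⋆ₙₐ[ℂ] CrossedProduct α where
  toFun f := fun g ↦ sign g • f g
  map_smul' c f := by
    ext g
    exact smul_comm _ _ _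
  map_zero' := by
    ext g
    exact smul_zero _
  map_add' f f' := by
    ext g
    exact smul_add _ _ _
  map_mul' f f' := by
    ext g
    change sign g • (∑ h, f h * α h (f' (h⁻¹ * g))) =
      ∑ h, (sign h • f h) * α h (sign (h⁻¹ * g) • f' (h⁻¹ * g))
    rw [Finset.smul_sum]
    refine Finset.sum_congr rfl fun h _ ↦ ?_
    rw [map_smul, smul_mul_smul_comm, ← sign_mul, mul_inv_cancel_left]
  map_star' f := by
    ext g
    change sign g • α g (star (f g⁻¹)) = α g (star (sign g⁻¹ • f g⁻¹))
    rw [star_smul, star_sign, sign_inv, map_smul]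

lemma dual_apply (f : CrossedProduct α) (g : Multiplicative (ZMod 2)) :
    dual α f g = sign g • f g := rfl

lemma dual_dual (f : CrossedProduct α) : dual α (dual α f) = f := by
  ext g
  rw [dual_apply, dual_apply, smul_smul, sign_mul_self, one_smul]

lemma incl_injective : Function.Injective (incl α) := fun _ _ h ↦
  Pi.single_injective (M := fun _ : Multiplicative (ZMod 2) ↦ A) 1 h

/-- Off the identity the sign is `-1`, so a fixed `f` satisfies `-f g = f g` there and is supported
at the identity. -/
lemma dual_eq_self_iff (f : CrossedProduct α) : dual α f = f ↔ ∃ a, incl α a = f := by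
  constructor
  · intro h
    refine ⟨f 1, ?_⟩
    ext g
    rw [incl_apply, single_apply]
    split_ifs with hg
    · rw [hg]
    · have h1 : sign g • f g = f g := congrFun h g
      rw [sign, if_neg hg, neg_smul, one_smul] at h1
      have h2 : (2 : ℂ) • f g = 0 := by
        rw [two_smul]
        nth_rewrite 1 [← h1]
        exact neg_add_cancel _
      exact ((smul_eq_zero.1 h2).resolve_left two_ne_zero).symm
  · rintro ⟨a, rfl⟩
    ext g
    rw [dual_apply, incl_apply, single_apply]
    split_ifs with hg
    · rw [sign, if_pos hg, one_smul]
    · rw [smul_zero]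

end CrossedProduct

/-! ### The four statements -/

theorem mainTheorem6 (𝒞 : CStarClass.{u}) (h𝒞 : 𝒞.UpwardsDirected)
    {A : Type u} [NonUnitalCStarAlgebra A]
    (α : Multiplicative (ZMod 2) →* (A ≃⋆ₐ[ℂ] A)) :
    (HereditarilyIn 𝒞 (fixedPointAlgebra α) → HereditarilyIn 𝒞 A) ∧
    (ResiduallyHereditarilyIn 𝒞 (fixedPointAlgebra α) → ResiduallyHereditarilyIn 𝒞 A) ∧
    (HereditarilyIn 𝒞 A → HereditarilyIn 𝒞 (CrossedProduct α)) ∧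
    (ResiduallyHereditarilyIn 𝒞 A → ResiduallyHereditarilyIn 𝒞 (CrossedProduct α)) := by
  let s : Multiplicative (ZMod 2) := Multiplicative.ofAdd 1
  let σ : A →⋆ₙₐ[ℂ] A := (α s : A →⋆ₙₐ[ℂ] A)
  let φ : fixedPointAlgebra α →⋆ₙₐ[ℂ] A := NonUnitalStarSubalgebraClass.subtype _
  have hφ : Function.Injective φ := Subtype.val_injective
  have hσ : ∀ a, σ (σ a) = a := fun a ↦ by
    change α s (α s a) = a
    rw [← StarAlgEquiv.mul_apply, ← map_mul, show s * s = 1 by decide, map_one,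
      StarAlgEquiv.one_apply]
  have hφσ : ∀ a, σ a = a ↔ ∃ f, φ f = a := fun a ↦ by
    constructor
    · intro h
      refine ⟨⟨a, fun g ↦ ?_⟩, rfl⟩
      rcases (by decide : ∀ g : Multiplicative (ZMod 2), g = 1 ∨ g = Multiplicative.ofAdd 1) g with
        rfl | rfl
      · rw [map_one, StarAlgEquiv.one_apply]
      · exact h
    · rintro ⟨f, rfl⟩
      exact f.2 s
  -- The involution is the generator of the action in the first two cases and the dual action in the
  -- last two.
  exact ⟨.of_fixedPoints h𝒞 hσ hφ hφσ, .of_fixedPoints h𝒞 hσ hφσ,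
    .of_fixedPoints h𝒞 (CrossedProduct.dual_dual α) (CrossedProduct.incl_injective α)
      (CrossedProduct.dual_eq_self_iff α),
    .of_fixedPoints h𝒞 (CrossedProduct.dual_dual α) (CrossedProduct.dual_eq_self_iff α)⟩
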